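/- **Theorem 2 ($n^{3/4}$-law).** There exist $\varepsilon_0\in(0,\pi/6)$ and a constant $c>0$ such that the following holds. Let $0<\varepsilon<\varepsilon_0$, $1<r_0<\sqrt2$, and let $v_2:[0,\infty)\to\mathbb R\cup\{+\infty\}$ and $v_3:[0,2\pi]\to\mathbb R$ satisfy - $v_2(1)=-1$ and $v_2(r)>-1$ for all $r\neq 1$; $v_2(r)=0$ for all $r\ge r_0$; $v_2(r)>\varepsilon^{-1}$ for all $r\in[0,1-\varepsilon]$; - $v_3(\theta)=v_3(2\pi-\theta)$ for all $\theta\in[0,2\pi]$; $v_3(\pi/2)=v_3(\pi)=v_3(3\pi/2)=0$ and $v_3(\theta)>0$ for all other $\theta\in[0,2\pi]$; - $v_3(\theta)\ge 4(\pi/6-\varepsilon)^{-1}|\theta-\pi|$ for all $\theta\in[\pi-\varepsilon,\pi+\varepsilon]$, with equality only if $\theta=\pi$; - $v_3(\theta)>\frac{4}{(1-\varepsilon)^2}\big(\sqrt2+\tfrac12\big)^2$ for all $\theta\in[0,2\pi]$ outside $[\frac{\pi}{2}-\varepsilon,\frac{\pi}{2}+\varepsilon]\cup[\pi-\varepsilon,\pi+\varepsilon]\cup[\frac{3\pi}{2}-\varepsilon,\frac{3\pi}{2}+\varepsilon]$.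 For a set $C=\{x_1,\dots,x_n\}\subset\mathbb R^2$ of $n$ distinct points define the energy $$\mathcal F(C)=\frac12\sum_{i\ne j}v_2(|x_i-x_j|)+\frac12\sum_{(i,j,k)}v_3(\theta_{i,j,k}),$$ where the second sum runs over all ordered triples of pairwise distinct indices with $|x_i-x_j|\le r_0$ and $|x_i-x_k|\le r_0$, and $\theta_{i,j,k}\in[0,2\pi)$ is the angle from $x_j-x_i$ to $x_k-x_i$, counted clockwise. A ground state with $n$ particles is a minimizer of $\mathcal F$ among all sets of $n$ points in $\mathbb R^2$. Then for every $n\in\mathbb N$ and every ground state $C_n$ with $n$ particles there is a rigid motion $\varphi$ of $\mathbb R^2$ (a rotation followed by a translation) such that $$\#\big(\varphi(C_n)\,\triangle\, S_n\big)\le c\,n^{3/4},\qquad S_n:=[1,\lceil\sqrt n\rceil]^2\cap\mathbb Z^2 .$$ The constant $c$ does not depend on $n$, $\varepsilon$, $r_0$, $v_2$ or $v_3$. -/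

import Mathlib

open scoped symmDiff

noncomputable section

namespace SquareCrystal

/-- The admissibility conditions on the two-body potential `v₂ : [0,∞) → ℝ ∪ {+∞}` and on the
three-body potential `v₃ : [0,2π] → ℝ`, with parameter `ε` and interaction range `r₀`.
Only the values of `v₂` on `[0,∞)` and of `v₃` on `[0,2π]` are constrained (and used);
`min₂` excludes the value `-∞`. -/
structure Admissible (ε r₀ : ℝ) (v₂ : ℝ → EReal) (v₃ : ℝ → ℝ) : Prop where
  value_one₂ : v₂ 1 = -1
  min₂ : ∀ r : ℝ, 0 ≤ r → r ≠ 1 → -1 < v₂ r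
  one_lt_r₀ : 1 < r₀
  r₀_lt : r₀ < Real.sqrt 2
  cutoff₂ : ∀ r : ℝ, r₀ ≤ r → v₂ r = 0
  repulsion₂ : ∀ r : ℝ, 0 ≤ r → r ≤ 1 - ε → ((ε⁻¹ : ℝ) : EReal) < v₂ r
  symm₃ : ∀ θ ∈ Set.Icc 0 (2 * Real.pi), v₃ θ = v₃ (2 * Real.pi - θ)
  zero₃ : v₃ (Real.pi / 2) = 0 ∧ v₃ Real.pi = 0 ∧ v₃ (3 * Real.pi / 2) = 0
  pos₃ : ∀ θ ∈ Set.Icc 0 (2 * Real.pi),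
    θ ≠ Real.pi / 2 → θ ≠ Real.pi → θ ≠ 3 * Real.pi / 2 → 0 < v₃ θ
  slope₃ : ∀ θ ∈ Set.Icc (Real.pi - ε) (Real.pi + ε),
    4 * (Real.pi / 6 - ε)⁻¹ * |θ - Real.pi| ≤ v₃ θ ∧
      (v₃ θ = 4 * (Real.pi / 6 - ε)⁻¹ * |θ - Real.pi| → θ = Real.pi)
  large₃ : ∀ θ ∈ Set.Icc 0 (2 * Real.pi),
    θ ∉ Set.Icc (Real.pi / 2 - ε) (Real.pi / 2 + ε) →
    θ ∉ Set.Icc (Real.pi - ε) (Real.pi + ε) →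
    θ ∉ Set.Icc (3 * Real.pi / 2 - ε) (3 * Real.pi / 2 + ε) →
    4 / (1 - ε) ^ 2 * (Real.sqrt 2 + 1 / 2) ^ 2 < v₃ θ

/-- The angle in `[0, 2π)` from the nonzero vector `u` to the nonzero vector `w`, counted
clockwise; the plane `ℝ²` is identified with `ℂ`. -/
def cwAngle (u w : ℂ) : ℝ :=
  toIcoMod Real.two_pi_pos 0 (Complex.arg (u / w))

/-- The particles of `C` that are bonded to `x`, i.e. the particles other than `x` at distance at
most `r₀` from `x`. -/
def neighbors (r₀ : ℝ) (C : Finset ℂ) (x : ℂ) : Finset ℂ :=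
  (C.erase x).filter fun y => dist x y ≤ r₀

/-- The configurational energy: one half of the sum of `v₂` over the ordered pairs of distinct
particles plus one half of the sum of `v₃` over the bond angles, i.e. over the ordered triples
`(x, y, z)` where `y ≠ z` are both bonded to `x`. -/
def energy (r₀ : ℝ) (v₂ : ℝ → EReal) (v₃ : ℝ → ℝ) (C : Finset ℂ) : EReal :=
  ((1 / 2 : ℝ) : EReal) * (∑ x ∈ C, ∑ y ∈ C.erase x, v₂ (dist x y)) +
    (((1 / 2 : ℝ) * ∑ x ∈ C, ∑ y ∈ neighbors r₀ C x, ∑ z ∈ (neighbors r₀ C x).erase y,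
      v₃ (cwAngle (y - x) (z - x)) : ℝ) : EReal)

/-- `C` is a ground state with `n` particles: it minimizes the energy among all configurations
of `n` (distinct) points of the plane. -/
def IsGroundState (r₀ : ℝ) (v₂ : ℝ → EReal) (v₃ : ℝ → ℝ) (n : ℕ) (C : Finset ℂ) : Prop :=
  C.card = n ∧ ∀ D : Finset ℂ, D.card = n → energy r₀ v₂ v₃ C ≤ energy r₀ v₂ v₃ D

/-- A rigid motion of the plane: a rotation followed by a translation. -/
def IsRigidMotion (φ : ℂ → ℂ) : Prop :=
  ∃ a b : ℂ, ‖a‖ = 1 ∧ ∀ z, φ z = a * z + b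

/-- The square `S_n = [1, ⌈√n⌉]² ∩ ℤ²`. -/
def square (n : ℕ) : Finset ℂ :=
  (Finset.Icc (1 : ℤ) ⌈Real.sqrt n⌉ ×ˢ Finset.Icc (1 : ℤ) ⌈Real.sqrt n⌉).image
    fun k => (⟨(k.1 : ℝ), (k.2 : ℝ)⟩ : ℂ)

end SquareCrystal

end

/-! The proof rests on an isoperimetric inequality that tolerates elastic deformation. In a subset
of ℤ², every maximal run of bonded points in a row or a column is a chain. If there are R chains
then the number of bonds is 2n - R, and since a horizontal and a vertical chain share at most one
point, 4n ≤ R². Both facts are extended to configurations whose bond angles are merely close to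
multiples of π/2.

For this, directions are rounded to sixteen sectors with a common offset s. A bond links two slots
(a particle with one of its two axes) when its sector agrees modulo 8 with the sectors of both. Each
resulting chain runs inside a convex cone, so it never closes up, and two chains in nearly
perpendicular sectors share at most one particle. Taking chains as vertices and particles as edges
gives a triangle-free graph, because no three sectors are pairwise nearly perpendicular, and
Mantel's theorem yields 4n ≤ R² (`ChainSystem.four_mul_card_le`). Rounding may cut a chain at a bent
straight angle, but after averaging over s the number of cuts is at most the total bending in units
of π/8 (`exists_shift`), and the slope of v₃ at π more than pays for it. Hence the energy is at
least R - 2n, with a surplus for every stretched bond and every bent angle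
(`exists_chain_number_le_energy`).

That bound needs regular angles. A ground state has them because a crowded particle, or one with a
bad angle, would gain energy by moving to infinity (`IsGroundState.lt_dist`,
`IsGroundState.goodAngles`).

Conversely, 4n ≤ R² allows n lattice points in a nearly square rectangle with energy at most R - 2n
(`exists_competitor`). So the surplus vanishes in a ground state: bonds have length one and angles
are multiples of π/2. The bond graph is connected, since two separate pieces would waste a chain, so
the ground state lies in one square lattice. It fills a rectangle of sides a, b with a + b ≤ ⌈2√n⌉
and ab ≥ n; thus |a - b| is of order n^(1/4), and strips of that width and length √n account for
n^(3/4). -/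

noncomputable section

namespace SquareCrystal

/-! ### Mantel's theorem -/

/-- Mantel's theorem for a family of pairs: if the pairs `{f x, g x}` are distinct and
nondegenerate and a relation excludes triangles, the number of pairs is at most a quarter of the
square of the number of points. -/
theorem mantel_of_pairs {α β : Type*} [DecidableEq α] [DecidableEq β] (C : Finset α) (R : Finset β)
    (f g : α → β) (hf : ∀ x ∈ C, f x ∈ R) (hg : ∀ x ∈ C, g x ∈ R) (P : β → β → Prop)
    (hP : ∀ a b, P a b → P b a) (hirr : ∀ a, ¬ P a a) (htri : ∀ a b c, P a b → P b c → ¬ P a c)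
    (hfg : ∀ x ∈ C, P (f x) (g x))
    (hinj : ∀ x ∈ C, ∀ y ∈ C, s(f x, g x) = s(f y, g y) → x = y) :
    4 * C.card ≤ R.card ^ 2 := by
  classical
  let G : SimpleGraph R :=
    { Adj := fun a b => P a b
      symm := ⟨fun a b h => hP _ _ h⟩
      loopless := ⟨fun a h => hirr _ h⟩ }
  have hfree : G.CliqueFree (2 + 1) := by
    intro s hs
    rw [SimpleGraph.is3Clique_iff] at hs
    obtain ⟨a, b, c, hab, hac, hbc, -⟩ := hs
    exact htri _ _ _ hab hbc hac
  have h1 := hfree.card_edgeFinset_le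
  have h2 : C.card ≤ G.edgeFinset.card := by
    rw [← Finset.card_attach]
    refine Finset.card_le_card_of_injOn
      (fun x => s(⟨f x.1, hf _ x.2⟩, ⟨g x.1, hg _ x.2⟩)) ?_ ?_
    · intro x hx
      simpa [G] using hfg _ x.2
    · intro x _ y _ hxy
      apply Subtype.ext
      apply hinj _ x.2 _ y.2
      have := congrArg (Sym2.map (Subtype.val)) hxy
      simpa using this
  rw [Fintype.card_coe] at h1
  have h3 : R.card % 2 = 0 ∨ R.card % 2 = 1 := by omega
  have h4 : (R.card ^ 2 - (R.card % 2) ^ 2) * (2 - 1) / (2 * 2) ≤ R.card ^ 2 / 4 := by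
    rw [show 2 - 1 = 1 from rfl, mul_one]
    exact Nat.div_le_div_right (Nat.sub_le _ _)
  have h5 : (R.card % 2).choose 2 = 0 := by rcases h3 with h | h <;> simp [h]
  omega

/-! ### Sectors and cones of directions -/

/-- The unit vector in the middle of the `T`-th of the sixteen sectors with offset `s`. -/
def sectorDir (s : ℝ) (T : ℤ) : ℂ := Complex.exp (((T + 1 / 2 + s) * (Real.pi / 8) : ℝ) * Complex.I)

/-- A convex cone around the `T`-th sector. -/
def InCone (s : ℝ) (T : ℤ) (v : ℂ) : Prop :=
  0 < (v / sectorDir s T).re ∧ |(v / sectorDir s T).im| ≤ (v / sectorDir s T).re / 4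

theorem InCone.add {s : ℝ} {T : ℤ} {v w : ℂ} (hv : InCone s T v) (hw : InCone s T w) :
    InCone s T (v + w) := by
  obtain ⟨h1, h2⟩ := hv
  obtain ⟨h3, h4⟩ := hw
  refine ⟨?_, ?_⟩
  · rw [add_div, Complex.add_re]; linarith
  · rw [add_div, Complex.add_re, Complex.add_im]
    exact (abs_add_le _ _).trans (by linarith)

theorem InCone.ne_zero {s : ℝ} {T : ℤ} {v : ℂ} (hv : InCone s T v) : v ≠ 0 := by
  rintro rfl
  have := hv.1
  simp at this

theorem sectorDir_add (s : ℝ) (T k : ℤ) :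
    sectorDir s (T + k) = sectorDir s T * Complex.exp ((k * (Real.pi / 8) : ℝ) * Complex.I) := by
  rw [sectorDir, sectorDir, ← Complex.exp_add]
  congr 1
  push_cast
  ring

theorem sectorDir_add_eight (s : ℝ) (T : ℤ) : sectorDir s (T + 8) = - sectorDir s T := by
  rw [sectorDir_add]
  have : ((((8 : ℤ) : ℝ) * (Real.pi / 8) : ℝ) : ℂ) = Real.pi := by push_cast; ring
  rw [this, Complex.exp_pi_mul_I]
  ring

theorem sectorDir_add_mul (s : ℝ) (T k : ℤ) : sectorDir s (T + 16 * k) = sectorDir s T := by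
  rw [sectorDir_add]
  have : ((((16 * k : ℤ) : ℝ) * (Real.pi / 8) : ℝ) : ℂ) * Complex.I = k * (2 * Real.pi * Complex.I) := by
    push_cast; ring
  rw [this, Complex.exp_int_mul_two_pi_mul_I, mul_one]

theorem InCone.congr {s : ℝ} {T T' : ℤ} {v : ℂ} (hv : InCone s T v) (h : T % 16 = T' % 16) :
    InCone s T' v := by
  have : T' = T + 16 * ((T' - T) / 16) := by omega
  rw [InCone, this, sectorDir_add_mul]
  exact hv

theorem InCone.neg {s : ℝ} {T : ℤ} {v : ℂ} (hv : InCone s T v) : InCone s (T + 8) (-v) := by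
  rw [InCone, sectorDir_add_eight, neg_div_neg_eq]
  exact hv

theorem re_im_mul_exp (z : ℂ) (t : ℝ) :
    (z / Complex.exp (t * Complex.I)).re = z.re * Real.cos t + z.im * Real.sin t ∧
    (z / Complex.exp (t * Complex.I)).im = z.im * Real.cos t - z.re * Real.sin t := by
  have : z / Complex.exp (t * Complex.I) = z * Complex.exp ((-t : ℝ) * Complex.I) := by
    rw [div_eq_mul_inv, ← Complex.exp_neg]; push_cast; ring_nf
  rw [this, Complex.exp_mul_I, ← Complex.ofReal_cos, ← Complex.ofReal_sin]
  simp only [Complex.mul_re, Complex.mul_im, Complex.add_re, Complex.add_im, Complex.ofReal_re,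
    Complex.ofReal_im, Complex.I_re, Complex.I_im, Real.cos_neg, Real.sin_neg]
  constructor <;> ring

theorem trig_of_mod {k : ℤ} (h1 : 3 ≤ k % 8) (h2 : k % 8 ≤ 5) :
    9 / 10 ≤ |Real.sin (k * (Real.pi / 8))| ∧ |Real.cos (k * (Real.pi / 8))| ≤ 4 / 10 := by
  have hp := Real.pi_gt_three
  have hp' := Real.pi_lt_d2
  obtain ⟨e, m, hk, he1, he2⟩ : ∃ e m : ℤ, k = 4 + e + 8 * m ∧ -1 ≤ e ∧ e ≤ 1 :=
    ⟨k % 8 - 4, k / 8, by omega, by omega, by omega⟩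
  have hx : (k : ℝ) * (Real.pi / 8) = (e * (Real.pi / 8) + Real.pi / 2) + m * Real.pi := by
    rw [hk]; push_cast; ring
  have he : |(e : ℝ) * (Real.pi / 8)| ≤ 4 / 10 := by
    have h1 : (-1 : ℝ) ≤ e := by exact_mod_cast he1
    have h2 : (e : ℝ) ≤ 1 := by exact_mod_cast he2
    rw [abs_le]; constructor <;> nlinarith
  have habs : ∀ y : ℝ, |y * (-1) ^ m.natAbs| = |y| := fun y => by simp [abs_mul]
  have hs : |Real.sin (k * (Real.pi / 8))| = |Real.cos (e * (Real.pi / 8))| := by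
    rw [hx, Real.sin_add_int_mul_pi, Real.sin_add_pi_div_two]
    simp [abs_mul]
  have hc : |Real.cos (k * (Real.pi / 8))| = |Real.sin (e * (Real.pi / 8))| := by
    rw [hx, Real.cos_add_int_mul_pi, Real.cos_add_pi_div_two]
    simp [abs_mul]
  rw [hs, hc]
  set y := (e : ℝ) * (Real.pi / 8)
  refine ⟨?_, (Real.abs_sin_le_abs).trans he⟩
  refine le_trans ?_ (le_abs_self _)
  have := Real.one_sub_sq_div_two_le_cos (x := y)
  rw [abs_le] at he
  nlinarith

/-- Modulo π the axes of the two cones are between 3π/8 and 5π/8 apart, while each cone has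
half-angle arctan(1/4). Rotating from one axis to the other nearly exchanges real and imaginary
parts, so a vector of the first cone has a dominant imaginary part in the frame of the second. -/
theorem cones_disjoint {s : ℝ} {T T' : ℤ} {v : ℂ} (h1 : 3 ≤ (T' - T) % 8) (h2 : (T' - T) % 8 ≤ 5)
    (hv : InCone s T v) (hv' : InCone s T' v) : False := by
  obtain ⟨k, hk⟩ : ∃ k, T' = T + k := ⟨T' - T, by ring⟩
  subst hk
  rw [add_sub_cancel_left] at h1 h2
  obtain ⟨hs, hc⟩ := trig_of_mod h1 h2
  rw [InCone, sectorDir_add, ← div_div] at hv'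
  obtain ⟨hre, him⟩ := re_im_mul_exp (v / sectorDir s T) (k * (Real.pi / 8))
  rw [hre, him] at hv'
  obtain ⟨ha, hb⟩ := hv
  obtain ⟨hc', hd⟩ := hv'
  set a := (v / sectorDir s T).re
  set b := (v / sectorDir s T).im
  set S := Real.sin (k * (Real.pi / 8))
  set K := Real.cos (k * (Real.pi / 8))
  have e1 : |a * S| ≤ |b * K - a * S| + |b * K| := by
    have := abs_sub (b * K) (b * K - a * S)
    rw [sub_sub_cancel] at this
    linarith [abs_sub (b * K) (b * K - a * S)]
  have e2 : a * K + b * S ≤ |a * K| + |b * S| := add_le_add (le_abs_self _) (le_abs_self _)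
  rw [abs_mul] at e1 e2
  rw [abs_mul] at e1 e2
  rw [abs_of_pos ha] at e1 e2
  have hS1 : |S| ≤ 1 := Real.abs_sin_le_one _
  have f1 : |b| * |K| ≤ a / 4 * (4 / 10) := by gcongr
  have f2 : a * (9 / 10) ≤ a * |S| := by gcongr
  have f3 : a * |K| ≤ a * (4 / 10) := by gcongr
  have f4 : |b| * |S| ≤ a / 4 * 1 := by gcongr
  linarith

/-! ### Chains of almost collinear bonds -/

/-- The data needed to decompose a bond graph into almost straight chains: the bonds at every
particle are distributed over two axes, every bond has a sector `F` modulo `16`, and every pair of a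
particle and an axis (a *slot*) has a sector `σ` modulo `8`. -/
structure ChainSystem (C : Finset ℂ) where
  s : ℝ
  N : ℂ → Finset ℂ
  axis : ℂ → ℂ → Bool
  F : ℂ → ℂ → ℤ
  σ : ℂ × Bool → ℤ
  mem_N : ∀ {x y}, y ∈ N x → y ∈ C
  symm : ∀ {x y}, x ∈ C → y ∈ N x → x ∈ N y
  rev : ∀ {x y}, x ∈ C → y ∈ N x → F y x % 16 = (F x y + 8) % 16
  opp : ∀ {x y z}, x ∈ C → y ∈ N x → z ∈ N x → y ≠ z → axis x y = axis x z →
    F x y % 8 = F x z % 8 → F x y % 16 ≠ F x z % 16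
  perp : ∀ x ∈ C, 3 ≤ (σ (x, true) - σ (x, false)) % 8 ∧ (σ (x, true) - σ (x, false)) % 8 ≤ 5
  cone : ∀ {x y}, x ∈ C → y ∈ N x → InCone s (F x y) (y - x)

namespace ChainSystem

variable {C : Finset ℂ} (K : ChainSystem C)

/-- The bond from `y` to the particle of the slot `a` is traversed forward and belongs to the same
chain as `a`. -/
def Precedes (a : ℂ × Bool) (y : ℂ) : Prop :=
  y ∈ K.N a.1 ∧ K.axis a.1 y = a.2 ∧ K.F a.1 y % 8 = K.σ a % 8 ∧ 8 ≤ K.F a.1 y % 16 ∧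
    K.F a.1 y % 8 = K.σ (y, K.axis y a.1) % 8

open Classical in
/-- The preceding slot on the chain; a slot at the beginning of a chain is a fixed point. -/
def pred (a : ℂ × Bool) : ℂ × Bool :=
  if h : ∃ y, K.Precedes a y then (h.choose, K.axis h.choose a.1) else a

variable {K}

theorem Precedes.unique {a : ℂ × Bool} (ha : a.1 ∈ C) {y z : ℂ} (hy : K.Precedes a y)
    (hz : K.Precedes a z) : y = z := by
  by_contra hne
  refine K.opp ha hy.1 hz.1 hne (hy.2.1.trans hz.2.1.symm) (hy.2.2.1.trans hz.2.2.1.symm) ?_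
  have h1 := hy.2.2.1.trans hz.2.2.1.symm
  have h2 := hy.2.2.2.1
  have h3 := hz.2.2.2.1
  omega

theorem Precedes.ne {a : ℂ × Bool} (ha : a.1 ∈ C) {y : ℂ} (hy : K.Precedes a y) : y ≠ a.1 := by
  intro h
  exact (K.cone ha hy.1).ne_zero (by rw [h, sub_self])

theorem pred_of_precedes {a : ℂ × Bool} (ha : a.1 ∈ C) {y : ℂ} (hy : K.Precedes a y) :
    K.pred a = (y, K.axis y a.1) := by
  have h : ∃ y, K.Precedes a y := ⟨y, hy⟩
  have := Precedes.unique ha h.choose_spec hy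
  rw [pred, dif_pos h, this]

theorem precedes_of_ne {a : ℂ × Bool} (h : K.pred a ≠ a) :
    ∃ y, K.Precedes a y ∧ K.pred a = (y, K.axis y a.1) := by
  by_cases h' : ∃ y, K.Precedes a y
  · exact ⟨h'.choose, h'.choose_spec, by rw [pred, dif_pos h']⟩
  · rw [pred, dif_neg h'] at h
    exact absurd rfl h

theorem pred_mem {a : ℂ × Bool} (ha : a.1 ∈ C) : (K.pred a).1 ∈ C := by
  by_cases h : K.pred a = a
  · rwa [h]
  · obtain ⟨y, hy, e⟩ := precedes_of_ne h
    rw [e]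
    exact K.mem_N hy.1

theorem σ_pred (a : ℂ × Bool) : K.σ (K.pred a) % 8 = K.σ a % 8 := by
  by_cases h : K.pred a = a
  · rw [h]
  · obtain ⟨y, hy, e⟩ := precedes_of_ne h
    rw [e, ← hy.2.2.2.2, hy.2.2.1]

/-- Two particles following the same slot would give it two bonds on one axis with the same sector
modulo 16, which `opp` excludes. -/
theorem pred_injective {a b : ℂ × Bool} (ha : a.1 ∈ C) (hb : b.1 ∈ C) (ha' : K.pred a ≠ a)
    (hb' : K.pred b ≠ b) (h : K.pred a = K.pred b) : a = b := by
  obtain ⟨y, hy, ey⟩ := precedes_of_ne ha'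
  obtain ⟨z, hz, ez⟩ := precedes_of_ne hb'
  rw [ey, ez, Prod.mk.injEq] at h
  obtain ⟨rfl, h⟩ := h
  have hab : a.1 = b.1 := by
    by_contra hne
    have hyC := K.mem_N hy.1
    have ra := K.rev ha hy.1
    have rb := K.rev hb hz.1
    have a1 := hy.2.2.2.1
    have a2 := hy.2.2.2.2
    have b1 := hz.2.2.2.1
    have b2 := hz.2.2.2.2
    rw [← h] at b2
    refine K.opp hyC (K.symm ha hy.1) (K.symm hb hz.1) hne h ?_ ?_ <;> omega
  have h2 : a.2 = b.2 := by rw [← hy.2.1, ← hz.2.1, hab]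
  exact Prod.ext hab h2

theorem inCone_pred {a : ℂ × Bool} (ha : a.1 ∈ C) (h : K.pred a ≠ a) :
    InCone K.s (K.σ a % 8) (a.1 - (K.pred a).1) := by
  obtain ⟨y, hy, e⟩ := precedes_of_ne h
  rw [e]
  have := (K.cone ha hy.1).neg
  rw [neg_sub] at this
  refine this.congr ?_
  have h1 := hy.2.2.1
  have h2 := hy.2.2.2.1
  omega

theorem iterate_mem {a : ℂ × Bool} (ha : a.1 ∈ C) (k : ℕ) : (K.pred^[k] a).1 ∈ C := by
  induction k with
  | zero => exact ha
  | succ k ih => rw [Function.iterate_succ_apply']; exact pred_mem ih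

theorem σ_iterate (a : ℂ × Bool) (k : ℕ) : K.σ (K.pred^[k] a) % 8 = K.σ a % 8 := by
  induction k with
  | zero => rfl
  | succ k ih => rw [Function.iterate_succ_apply', σ_pred, ih]

/-- The sector of the slot modulo 8 is constant along a chain and the cone is closed under addition,
so the steps add up inside a single cone. -/
theorem inCone_iterate (k : ℕ) : ∀ {a : ℂ × Bool}, a.1 ∈ C → K.pred a ≠ a →
    InCone K.s (K.σ a % 8) (a.1 - (K.pred^[k + 1] a).1) := by
  induction k with
  | zero => intro a ha h; exact inCone_pred ha h
  | succ k ih =>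
    intro a ha h
    rw [Function.iterate_succ_apply]
    have h1 := inCone_pred ha h
    by_cases h2 : K.pred (K.pred a) = K.pred a
    · rw [Function.iterate_fixed h2]; exact h1
    · have h3 := ih (pred_mem ha) h2
      rw [σ_pred] at h3
      have := h1.add h3
      rwa [sub_add_sub_cancel] at this

theorem eq_or_inCone_iterate {a : ℂ × Bool} (ha : a.1 ∈ C) (k : ℕ) :
    (K.pred^[k] a).1 = a.1 ∨ InCone K.s (K.σ a % 8) (a.1 - (K.pred^[k] a).1) := by
  by_cases h : K.pred a = a
  · rw [Function.iterate_fixed h]; exact Or.inl rfl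
  · cases k with
    | zero => exact Or.inl rfl
    | succ k => exact Or.inr (inCone_iterate k ha h)

-- The iterates live in a finite set, so two of them coincide. A return after a genuine step would
-- put 0 into a cone; hence the orbit stops.
variable (K) in
theorem exists_root (a : ℂ × Bool) (ha : a.1 ∈ C) :
    ∃ r, (∃ k, K.pred^[k] a = r) ∧ K.pred r = r := by
  obtain ⟨k, l, hkl, h⟩ := Finite.exists_ne_map_eq_of_infinite
    (fun k : ℕ => (⟨K.pred^[k] a, Finset.mem_product.2 ⟨iterate_mem ha k, Finset.mem_univ _⟩⟩ :
      (C ×ˢ (Finset.univ : Finset Bool) : Finset (ℂ × Bool))))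
  wlog hlt : k < l generalizing k l
  · exact this l k hkl.symm h.symm (by omega)
  have h := congrArg Subtype.val h
  refine ⟨K.pred^[k] a, ⟨k, rfl⟩, ?_⟩
  by_contra hne
  obtain ⟨m, rfl⟩ : ∃ m, l = (m + 1) + k := ⟨l - k - 1, by omega⟩
  have h2 := inCone_iterate m (iterate_mem ha k) hne
  rw [← Function.iterate_add_apply] at h2
  apply h2.ne_zero
  simp only at h
  rw [← h, sub_self]

variable (K) in
open Classical in
/-- The beginning of the chain through a slot. -/
def root (a : ℂ × Bool) : ℂ × Bool :=
  if h : a.1 ∈ C then (K.exists_root a h).choose else a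

theorem root_spec {a : ℂ × Bool} (ha : a.1 ∈ C) :
    (∃ k, K.pred^[k] a = K.root a) ∧ K.pred (K.root a) = K.root a := by
  rw [root, dif_pos ha]
  exact (K.exists_root a ha).choose_spec

theorem σ_root {a : ℂ × Bool} (ha : a.1 ∈ C) : K.σ (K.root a) % 8 = K.σ a % 8 := by
  obtain ⟨⟨k, hk⟩, -⟩ := root_spec (K := K) ha
  rw [← hk, σ_iterate]

/-- Because `pred` is injective away from its fixed points, orbits with a common value do not merge
from two branches: a chain is linearly ordered. -/
theorem comparable_of_iterate {r : ℂ × Bool} (k : ℕ) :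
    ∀ {a b : ℂ × Bool} {l : ℕ}, a.1 ∈ C → b.1 ∈ C → K.pred^[k] a = r → K.pred^[l] b = r →
      ∃ j, K.pred^[j] a = b ∨ K.pred^[j] b = a := by
  induction k with
  | zero =>
    intro a b l _ _ h1 h2
    exact ⟨l, Or.inr (h2.trans h1.symm)⟩
  | succ k ih =>
    intro a b l ha hb h1 h2
    by_cases hfix : K.pred a = a
    · rw [Function.iterate_fixed hfix] at h1
      exact ⟨l, Or.inr (h2.trans h1.symm)⟩
    rw [Function.iterate_succ_apply] at h1
    obtain ⟨j, h | h⟩ := ih (pred_mem ha) hb h1 h2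
    · exact ⟨j + 1, Or.inl h⟩
    · clear h2
      induction j with
      | zero => exact ⟨1, Or.inl h.symm⟩
      | succ j ihj =>
        rw [Function.iterate_succ_apply'] at h
        by_cases hb' : K.pred (K.pred^[j] b) = K.pred^[j] b
        · exact ihj (hb'.symm.trans h)
        · exact ⟨j, Or.inr (pred_injective (iterate_mem hb j) ha hb' hfix h)⟩

theorem eq_or_inCone_of_root_eq {a b : ℂ × Bool} (ha : a.1 ∈ C) (hb : b.1 ∈ C)
    (h : K.root a = K.root b) :
    a.1 = b.1 ∨ InCone K.s (K.σ a % 8) (a.1 - b.1) ∨ InCone K.s (K.σ a % 8 + 8) (a.1 - b.1) := by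
  obtain ⟨⟨k, hk⟩, -⟩ := root_spec (K := K) ha
  obtain ⟨⟨l, hl⟩, -⟩ := root_spec (K := K) hb
  obtain ⟨j, hj | hj⟩ := comparable_of_iterate k ha hb hk (hl.trans h.symm)
  · rcases eq_or_inCone_iterate (K := K) ha j with h | h
    · rw [hj] at h; exact Or.inl h.symm
    · rw [hj] at h; exact Or.inr (Or.inl h)
  · have hσ : K.σ b % 8 = K.σ a % 8 := by rw [← σ_root hb, ← h, σ_root ha]
    rcases eq_or_inCone_iterate (K := K) hb j with h | h
    · rw [hj] at h; exact Or.inl h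
    · rw [hj, hσ] at h
      have := h.neg
      rw [neg_sub] at this
      exact Or.inr (Or.inr this)

/-- If two particles shared both chains, their difference would lie in cones around two nearly
perpendicular directions. The pairs are unordered, so the first chain of one particle may be the
second of the other. -/
theorem eq_of_roots_eq {x y : ℂ} (hx : x ∈ C) (hy : y ∈ C)
    (h : s(K.root (x, true), K.root (x, false)) = s(K.root (y, true), K.root (y, false))) :
    x = y := by
  have key : ∀ i j : Bool, K.root (x, true) = K.root (y, i) → K.root (x, false) = K.root (y, j) →
      x = y := by
    intro i j h1 h2
    have p := K.perp x hx
    rcases eq_or_inCone_of_root_eq (K := K) (a := (x, true)) (b := (y, i)) hx hy h1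
      with h1 | h1 | h1
    · exact h1
    all_goals
      rcases eq_or_inCone_of_root_eq (K := K) (a := (x, false)) (b := (y, j)) hx hy h2
        with h2 | h2 | h2
      · exact h2
      all_goals exact (cones_disjoint (by omega) (by omega) h2 h1).elim
  rw [Sym2.eq_iff] at h
  rcases h with ⟨h1, h2⟩ | ⟨h1, h2⟩
  · exact key _ _ h1 h2
  · exact key _ _ h1 h2

variable (K) in
open Classical in
/-- The beginnings of the chains. -/
def roots : Finset (ℂ × Bool) := (C ×ˢ Finset.univ).filter fun a => K.pred a = a

variable (K) in
theorem four_mul_card_le : 4 * C.card ≤ K.roots.card ^ 2 := by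
  classical
  have hmem : ∀ x ∈ C, ∀ i, K.root (x, i) ∈ K.roots := by
    intro x hx i
    obtain ⟨⟨k, hk⟩, hr⟩ := root_spec (K := K) (a := (x, i)) hx
    refine Finset.mem_filter.2 ⟨Finset.mem_product.2 ⟨?_, Finset.mem_univ _⟩, hr⟩
    rw [← hk]
    exact iterate_mem (K := K) (a := (x, i)) hx k
  refine mantel_of_pairs C K.roots (fun x => K.root (x, true)) (fun x => K.root (x, false))
    (fun x hx => hmem x hx _) (fun x hx => hmem x hx _)
    -- Adjacency means nearly perpendicular sectors. Two differences in {3, 4, 5} never add up to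
    -- one of 3, 4, 5 modulo 8, so there are no triangles.
    (fun a b => 3 ≤ (K.σ a - K.σ b) % 8 ∧ (K.σ a - K.σ b) % 8 ≤ 5) ?_ ?_ ?_ ?_ ?_
  · intro a b h; omega
  · intro a h; omega
  · intro a b c h1 h2 h3; omega
  · intro x hx
    have h1 := σ_root (K := K) (a := (x, true)) hx
    have h2 := σ_root (K := K) (a := (x, false)) hx
    have h3 := K.perp x hx
    omega
  · intro x hx y hy h
    exact eq_of_roots_eq hx hy h

variable (K) in
/-- The oriented bonds. -/
def darts : Finset (ℂ × ℂ) := (C ×ˢ C).filter fun p => p.2 ∈ K.N p.1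

variable (K) in
/-- The oriented bonds whose sector differs from the one of their slot. -/
def badDarts : Finset (ℂ × ℂ) :=
  K.darts.filter fun p => K.F p.1 p.2 % 8 ≠ K.σ (p.1, K.axis p.1 p.2) % 8

theorem mem_darts {p : ℂ × ℂ} : p ∈ K.darts ↔ p.1 ∈ C ∧ p.2 ∈ K.N p.1 := by
  rw [darts, Finset.mem_filter, Finset.mem_product]
  exact ⟨fun h => ⟨h.1.1, h.2⟩, fun h => ⟨⟨h.1, K.mem_N h.2⟩, h.2⟩⟩

theorem swap_mem_darts {p : ℂ × ℂ} (h : p ∈ K.darts) : p.swap ∈ K.darts := by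
  rw [mem_darts] at h ⊢
  exact ⟨K.mem_N h.2, K.symm h.1 h.2⟩

-- Every slot is either the start of a chain or receives exactly one link, so links number 2|C|
-- minus the chains. Each bond has one backward orientation, and this is a link unless the bond is
-- bad at one of its two ends.
variable (K) in
theorem two_mul_card_roots_add_le :
    2 * K.roots.card + K.darts.card ≤ 4 * C.card + 2 * K.badDarts.card := by
  classical
  set Bk := K.darts.filter fun p => 8 ≤ K.F p.1 p.2 % 16 with hBk
  set Fw := K.darts.filter fun p => ¬ 8 ≤ K.F p.1 p.2 % 16 with hFw
  have h1 : Bk.card + Fw.card = K.darts.card := Finset.card_filter_add_card_filter_not _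
  have h2 : Fw.card ≤ Bk.card := by
    refine Finset.card_le_card_of_injOn Prod.swap ?_ (Prod.swap_injective.injOn)
    intro p hp
    have hp := Finset.mem_filter.1 (Finset.mem_coe.1 hp)
    have hd := mem_darts.1 hp.1
    have := K.rev hd.1 hd.2
    refine Finset.mem_coe.2 (Finset.mem_filter.2 ⟨swap_mem_darts hp.1, ?_⟩)
    have h := hp.2
    simp only [Prod.fst_swap, Prod.snd_swap]
    omega
  have h2' : Bk.card ≤ Fw.card := by
    refine Finset.card_le_card_of_injOn Prod.swap ?_ (Prod.swap_injective.injOn)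
    intro p hp
    have hp := Finset.mem_filter.1 (Finset.mem_coe.1 hp)
    have hd := mem_darts.1 hp.1
    have := K.rev hd.1 hd.2
    refine Finset.mem_coe.2 (Finset.mem_filter.2 ⟨swap_mem_darts hp.1, ?_⟩)
    have h := hp.2
    simp only [Prod.fst_swap, Prod.snd_swap]
    omega
  set Q := K.darts.filter fun p => K.Precedes (p.1, K.axis p.1 p.2) p.2 with hQ
  set Nr := (C ×ˢ (Finset.univ : Finset Bool)).filter fun a => ¬ K.pred a = a with hNr
  have h3 : K.roots.card + Nr.card = 2 * C.card := by
    have : K.roots.card + Nr.card = (C ×ˢ (Finset.univ : Finset Bool)).card :=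
      Finset.card_filter_add_card_filter_not _
    rw [this, Finset.card_product]
    simp [mul_comm]
  have h4 : Q.card ≤ Nr.card := by
    refine Finset.card_le_card_of_injOn (fun p => (p.1, K.axis p.1 p.2)) ?_ ?_
    · intro p hp
      obtain ⟨hd, hp⟩ := Finset.mem_filter.1 (Finset.mem_coe.1 hp)
      have hd := mem_darts.1 hd
      refine Finset.mem_coe.2 (Finset.mem_filter.2
        ⟨Finset.mem_product.2 ⟨hd.1, Finset.mem_univ _⟩, ?_⟩)
      rw [pred_of_precedes hd.1 hp]
      intro h
      exact hp.ne hd.1 (congrArg Prod.fst h)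
    · intro p hp q hq h
      obtain ⟨hd, hp⟩ := Finset.mem_filter.1 (Finset.mem_coe.1 hp)
      obtain ⟨-, hq⟩ := Finset.mem_filter.1 (Finset.mem_coe.1 hq)
      have hd := mem_darts.1 hd
      simp only at h
      rw [← h] at hq
      have hfst : p.1 = q.1 := congrArg (fun a : ℂ × Bool => a.1) h
      exact Prod.ext hfst (Precedes.unique hd.1 hp hq)
  have h5 : Bk.card ≤ Q.card + K.badDarts.card := by
    have e : (K.badDarts.filter fun p => 8 ≤ K.F p.1 p.2 % 16).card +
        (K.badDarts.filter fun p => ¬ 8 ≤ K.F p.1 p.2 % 16).card = K.badDarts.card :=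
      Finset.card_filter_add_card_filter_not _
    -- A defect at the particle itself makes the dart bad; a defect at the other end makes the
    -- reversed dart bad. Bad darts split by orientation, so each is charged once.
    have e2 : Bk ⊆ Q ∪ ((K.badDarts.filter fun p => 8 ≤ K.F p.1 p.2 % 16) ∪
        (K.badDarts.filter fun p => ¬ 8 ≤ K.F p.1 p.2 % 16).image Prod.swap) := by
      intro p hp
      obtain ⟨hd, hp⟩ := Finset.mem_filter.1 hp
      have hd' := mem_darts.1 hd
      have hrev := K.rev hd'.1 hd'.2
      by_cases c1 : K.F p.1 p.2 % 8 = K.σ (p.1, K.axis p.1 p.2) % 8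
      · by_cases c2 : K.F p.1 p.2 % 8 = K.σ (p.2, K.axis p.2 p.1) % 8
        · exact Finset.mem_union_left _ (Finset.mem_filter.2 ⟨hd, hd'.2, rfl, c1, hp, c2⟩)
        · refine Finset.mem_union_right _ (Finset.mem_union_right _ (Finset.mem_image.2
            ⟨p.swap, Finset.mem_filter.2 ⟨Finset.mem_filter.2 ⟨swap_mem_darts hd, ?_⟩, ?_⟩,
              Prod.swap_swap p⟩))
          · simp only [Prod.fst_swap, Prod.snd_swap]; omega
          · simp only [Prod.fst_swap, Prod.snd_swap]; omega
      · exact Finset.mem_union_right _ (Finset.mem_union_left _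
          (Finset.mem_filter.2 ⟨Finset.mem_filter.2 ⟨hd, c1⟩, hp⟩))
    have e3 := Finset.card_le_card e2
    have e4 := Finset.card_union_le Q ((K.badDarts.filter fun p => 8 ≤ K.F p.1 p.2 % 16) ∪
        (K.badDarts.filter fun p => ¬ 8 ≤ K.F p.1 p.2 % 16).image Prod.swap)
    have e5 := Finset.card_union_le (K.badDarts.filter fun p => 8 ≤ K.F p.1 p.2 % 16)
        ((K.badDarts.filter fun p => ¬ 8 ≤ K.F p.1 p.2 % 16).image Prod.swap)
    have e6 : ((K.badDarts.filter fun p => ¬ 8 ≤ K.F p.1 p.2 % 16).image Prod.swap).card ≤ _ :=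
      Finset.card_image_le
    omega
  omega

end ChainSystem

/-! ### Averaging over the offset of a grid -/

theorem intervalIntegrable_fract (a : ℝ) :
    IntervalIntegrable (fun s => Int.fract (a - s)) MeasureTheory.volume 0 1 := by
  rw [intervalIntegrable_iff]
  refine MeasureTheory.Measure.integrableOn_of_bounded (M := 1) (by simp) ?_ ?_
  · exact (measurable_fract.comp (measurable_const.sub measurable_id)).aestronglyMeasurable
  · refine Filter.Eventually.of_forall fun s => ?_
    rw [Real.norm_eq_abs, abs_of_nonneg (Int.fract_nonneg _)]
    exact (Int.fract_lt_one _).le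

theorem integral_fract (a : ℝ) :
    ∫ s in (0 : ℝ)..1, Int.fract (a - s) = ∫ s in (0 : ℝ)..1, Int.fract s := by
  rw [intervalIntegral.integral_comp_sub_left (fun s => Int.fract s) a]
  have hper : Function.Periodic (fun s : ℝ => Int.fract s) 1 := fun s => Int.fract_add_one s
  have := hper.intervalIntegral_add_eq (a - 1) 0
  simpa using this

theorem floor_sub_floor_eq (a b s : ℝ) :
    ((⌊a - s⌋ : ℤ) : ℝ) - ⌊b - s⌋ = (a - b) - Int.fract (a - s) + Int.fract (b - s) := by
  have h1 := Int.floor_add_fract (a - s)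
  have h2 := Int.floor_add_fract (b - s)
  linarith

theorem integral_floor_sub_floor (a b : ℝ) :
    IntervalIntegrable (fun s => ((⌊a - s⌋ : ℤ) : ℝ) - ⌊b - s⌋) MeasureTheory.volume 0 1 ∧
    ∫ s in (0 : ℝ)..1, (((⌊a - s⌋ : ℤ) : ℝ) - ⌊b - s⌋) = a - b := by
  simp_rw [floor_sub_floor_eq]
  have ia := intervalIntegrable_fract a
  have ib := intervalIntegrable_fract b
  have ic : IntervalIntegrable (fun _ : ℝ => a - b) MeasureTheory.volume 0 1 :=
    intervalIntegrable_const
  refine ⟨(ic.sub ia).add ib, ?_⟩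
  rw [intervalIntegral.integral_add (ic.sub ia) ib, intervalIntegral.integral_sub ic ia,
    integral_fract, integral_fract]
  simp

/-- The sign of the difference of floors does not depend on s, so the absolute value can be removed;
the fractional parts have equal means by periodicity and cancel. -/
theorem integral_abs_floor_sub_floor (a b : ℝ) :
    IntervalIntegrable (fun s => |((⌊a - s⌋ : ℤ) : ℝ) - ⌊b - s⌋|) MeasureTheory.volume 0 1 ∧
    ∫ s in (0 : ℝ)..1, |((⌊a - s⌋ : ℤ) : ℝ) - ⌊b - s⌋| = |a - b| := by
  wlog h : b ≤ a generalizing a b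
  · have := this b a (le_of_not_ge h)
    simp_rw [abs_sub_comm] at this ⊢
    exact this
  · have : ∀ s, |((⌊a - s⌋ : ℤ) : ℝ) - ⌊b - s⌋| = ((⌊a - s⌋ : ℤ) : ℝ) - ⌊b - s⌋ := by
      intro s
      rw [abs_of_nonneg]
      have : ⌊b - s⌋ ≤ ⌊a - s⌋ := Int.floor_le_floor (by linarith)
      have : ((⌊b - s⌋ : ℤ) : ℝ) ≤ ⌊a - s⌋ := by exact_mod_cast this
      linarith
    simp_rw [this]
    rw [abs_of_nonneg (by linarith)]
    exact integral_floor_sub_floor a b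

/-- A shift of the grid of integers that separates at most as many of the pairs `a i`, `b i` as
their total distance. -/
theorem exists_shift {ι : Type*} (I : Finset ι) (a b : ι → ℝ) :
    ∃ s : ℝ, ((I.filter fun i => ⌊a i - s⌋ ≠ ⌊b i - s⌋).card : ℝ) ≤ ∑ i ∈ I, |a i - b i| := by
  by_contra! hcon
  set S := ∑ i ∈ I, |a i - b i| with hS
  have hS0 : 0 ≤ S := Finset.sum_nonneg fun i _ => abs_nonneg _
  -- The number of separated pairs is an integer, so exceeding S for every s means being at least
  -- ⌊S⌋ + 1. This uniform gap survives integration.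
  have h1 : ∀ s : ℝ, ((⌊S⌋₊ : ℝ) + 1) ≤ ∑ i ∈ I, |((⌊a i - s⌋ : ℤ) : ℝ) - ⌊b i - s⌋| := by
    intro s
    have h2 := hcon s
    have h3 : ⌊S⌋₊ + 1 ≤ (I.filter fun i => ⌊a i - s⌋ ≠ ⌊b i - s⌋).card :=
      (Nat.floor_lt hS0).2 h2
    have h4 : ((⌊S⌋₊ : ℝ) + 1) ≤ (I.filter fun i => ⌊a i - s⌋ ≠ ⌊b i - s⌋).card := by
      exact_mod_cast h3
    refine h4.trans ?_
    rw [Finset.card_filter]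
    push_cast
    refine Finset.sum_le_sum fun i _ => ?_
    split_ifs with h
    · have : 1 ≤ |⌊a i - s⌋ - ⌊b i - s⌋| := Int.one_le_abs (sub_ne_zero.2 h)
      exact_mod_cast this
    · exact abs_nonneg _
  have hint : ∀ i ∈ I, IntervalIntegrable
      (fun s => |((⌊a i - s⌋ : ℤ) : ℝ) - ⌊b i - s⌋|) MeasureTheory.volume 0 1 :=
    fun i _ => (integral_abs_floor_sub_floor _ _).1
  have h5 : ∫ s in (0 : ℝ)..1, ∑ i ∈ I, |((⌊a i - s⌋ : ℤ) : ℝ) - ⌊b i - s⌋| = S := by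
    rw [intervalIntegral.integral_finsetSum hint]
    exact Finset.sum_congr rfl fun i _ => (integral_abs_floor_sub_floor _ _).2
  have hsum : IntervalIntegrable
      (fun s => ∑ i ∈ I, |((⌊a i - s⌋ : ℤ) : ℝ) - ⌊b i - s⌋|) MeasureTheory.volume 0 1 := by
    have := IntervalIntegrable.sum I hint
    rwa [show (∑ i ∈ I, fun s => |((⌊a i - s⌋ : ℤ) : ℝ) - ⌊b i - s⌋|) =
      fun s => ∑ i ∈ I, |((⌊a i - s⌋ : ℤ) : ℝ) - ⌊b i - s⌋| from
        funext fun s => Finset.sum_apply _ _ _] at this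
  have h6 : ∫ _s in (0 : ℝ)..1, ((⌊S⌋₊ : ℝ) + 1) ≤
      ∫ s in (0 : ℝ)..1, ∑ i ∈ I, |((⌊a i - s⌋ : ℤ) : ℝ) - ⌊b i - s⌋| :=
    intervalIntegral.integral_mono_on zero_le_one intervalIntegrable_const
      hsum fun s _ => h1 s
  rw [h5] at h6
  simp only [intervalIntegral.integral_const, sub_zero, one_smul] at h6
  have := Nat.lt_floor_add_one S
  linarith

/-! ### Chain decomposition of configurations with regular angles -/

/-- The difference of the directions of `y` and `z` seen from `x`. -/
def turn (x y z : ℂ) : ℝ := Complex.arg (y - x) - Complex.arg (z - x)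

/-- The nearest multiple of a right angle. -/
def quarter (x y z : ℂ) : ℤ := round (turn x y z / (Real.pi / 2))

/-- The deviation of an angle from the nearest multiple of a right angle. -/
def deviation (x y z : ℂ) : ℝ := turn x y z - quarter x y z * (Real.pi / 2)

/-- All bond angles are close to a right angle or to a straight angle. -/
def RegularAngles (r₀ : ℝ) (C : Finset ℂ) : Prop :=
  ∀ x ∈ C, ∀ y ∈ neighbors r₀ C x, ∀ z ∈ neighbors r₀ C x, y ≠ z →
    |deviation x y z| ≤ 1 / 100 ∧ quarter x y z % 4 ≠ 0

theorem quarter_self (x y : ℂ) : quarter x y y = 0 := by simp [quarter, turn]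

theorem deviation_self (x y : ℂ) : deviation x y y = 0 := by
  simp [deviation, quarter_self, turn]

theorem mem_neighbors {r₀ : ℝ} {C : Finset ℂ} {x y : ℂ} :
    y ∈ neighbors r₀ C x ↔ y ≠ x ∧ y ∈ C ∧ dist x y ≤ r₀ := by
  rw [neighbors, Finset.mem_filter, Finset.mem_erase, and_assoc]

theorem neighbors_symm {r₀ : ℝ} {C : Finset ℂ} {x y : ℂ} (hx : x ∈ C)
    (h : y ∈ neighbors r₀ C x) : x ∈ neighbors r₀ C y := by
  rw [mem_neighbors] at h ⊢
  exact ⟨h.1.symm, hx, by rw [dist_comm]; exact h.2.2⟩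

/-- The direction of `y` seen from `x`, in units of a sixteenth of a full turn. -/
def direction (x y : ℂ) : ℝ := 8 / Real.pi * Complex.arg (y - x)

theorem direction_sub (x y z : ℂ) :
    direction x y - direction x z = 4 * quarter x y z + 8 / Real.pi * deviation x y z := by
  have := Real.pi_ne_zero
  rw [direction, direction, deviation, turn]
  field_simp
  ring

theorem exists_direction_swap {x y : ℂ} (h : x ≠ y) :
    ∃ k : ℤ, direction y x = direction x y + (8 + 16 * k : ℤ) := by
  have h1 := Complex.arg_neg_coe_angle (sub_ne_zero.2 h.symm)
  rw [neg_sub, ← Real.Angle.coe_add, Real.Angle.angle_eq_iff_two_pi_dvd_sub] at h1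
  obtain ⟨k, hk⟩ := h1
  refine ⟨k, ?_⟩
  have := Real.pi_ne_zero
  rw [direction, direction, eq_add_of_sub_eq hk]
  push_cast
  field_simp
  ring

theorem inCone_floor (s : ℝ) {v : ℂ} (hv : v ≠ 0) :
    InCone s ⌊8 / Real.pi * Complex.arg v - s⌋ v := by
  set T := ⌊8 / Real.pi * Complex.arg v - s⌋ with hT
  set φ := Complex.arg v - (T + 1 / 2 + s) * (Real.pi / 8) with hφ
  have hp := Real.pi_pos
  -- The half-width of a sector is π/16 < 1/5. Then |sin φ| ≤ 1/5 and cos φ ≥ 49/50, which fits into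
  -- the slope 1/4 of the cone.
  have hφ' : |φ| ≤ 1 / 5 := by
    have h1 : (T : ℝ) ≤ _ := Int.floor_le (8 / Real.pi * Complex.arg v - s)
    have h2 : _ < (T : ℝ) + 1 := Int.lt_floor_add_one (8 / Real.pi * Complex.arg v - s)
    have h3 : φ = Real.pi / 8 * (8 / Real.pi * Complex.arg v - s - T - 1 / 2) := by
      rw [hφ]; field_simp; ring
    have h4 := Real.pi_lt_d2
    rw [h3, abs_mul, abs_of_pos (by positivity)]
    have h5 : |8 / Real.pi * Complex.arg v - s - T - 1 / 2| ≤ 1 / 2 := by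
      rw [abs_le]; constructor <;> linarith
    calc Real.pi / 8 * _ ≤ Real.pi / 8 * (1 / 2) := by gcongr
      _ ≤ 1 / 5 := by linarith
  have hv' : v / sectorDir s T = ((‖v‖ : ℝ) : ℂ) * Complex.exp ((φ : ℝ) * Complex.I) := by
    conv_lhs => rw [← Complex.norm_mul_exp_arg_mul_I v]
    rw [sectorDir, mul_div_assoc, ← Complex.exp_sub, hφ]
    congr 2
    push_cast
    ring
  have hn : 0 < ‖v‖ := norm_pos_iff.2 hv
  rw [InCone, hv', Complex.re_ofReal_mul, Complex.im_ofReal_mul, Complex.exp_ofReal_mul_I_re,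
    Complex.exp_ofReal_mul_I_im, abs_mul, abs_of_pos hn]
  have hc := Real.one_sub_sq_div_two_le_cos (x := φ)
  have hs := (Real.abs_sin_le_abs (x := φ)).trans hφ'
  have hsq : φ ^ 2 ≤ 1 / 25 := by
    rw [← sq_abs]; nlinarith [abs_nonneg φ]
  constructor
  · apply mul_pos hn; linarith
  · rw [mul_div_assoc]
    gcongr
    linarith

section Regular

variable {r₀ : ℝ} {C : Finset ℂ} (hC : RegularAngles r₀ C) {x : ℂ} (hx : x ∈ C)
include hC hx

theorem abs_deviation_le {y z : ℂ} (hy : y ∈ neighbors r₀ C x) (hz : z ∈ neighbors r₀ C x) :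
    |deviation x y z| ≤ 1 / 100 := by
  by_cases h : y = z
  · rw [h, deviation_self]; norm_num
  · exact (hC x hx y hy z hz h).1

/-- The error of additivity is an integer multiple of π/2, yet it is made of three deviations and so
is at most 3/100. -/
theorem quarter_add {y z w : ℂ} (hy : y ∈ neighbors r₀ C x) (hz : z ∈ neighbors r₀ C x)
    (hw : w ∈ neighbors r₀ C x) : quarter x y w = quarter x y z + quarter x z w := by
  have h1 := abs_deviation_le hC hx hy hz
  have h2 := abs_deviation_le hC hx hz hw
  have h3 := abs_deviation_le hC hx hy hw
  have hp := Real.pi_gt_three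
  have key : deviation x y w - deviation x y z - deviation x z w =
      ((quarter x y z + quarter x z w - quarter x y w : ℤ) : ℝ) * (Real.pi / 2) := by
    simp only [deviation, turn]; push_cast; ring
  by_contra hne
  have h4 : 1 ≤ |quarter x y z + quarter x z w - quarter x y w| :=
    Int.one_le_abs (by omega)
  have h5 : (1 : ℝ) ≤ |((quarter x y z + quarter x z w - quarter x y w : ℤ) : ℝ)| := by
    exact_mod_cast h4
  have h6 := congrArg abs key
  rw [abs_mul, abs_of_pos (by positivity : 0 < Real.pi / 2)] at h6
  have h7 : |deviation x y w - deviation x y z - deviation x z w| ≤ 3 / 100 := by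
    rw [abs_le] at *
    constructor <;> linarith
  nlinarith

theorem floor_direction_sub (s : ℝ) {y z : ℂ} (hy : y ∈ neighbors r₀ C x)
    (hz : z ∈ neighbors r₀ C x) :
    -1 ≤ ⌊direction x y - s⌋ - ⌊direction x z - s⌋ - 4 * quarter x y z ∧
      ⌊direction x y - s⌋ - ⌊direction x z - s⌋ - 4 * quarter x y z ≤ 1 := by
  have h1 := abs_deviation_le hC hx hy hz
  have h2 := direction_sub x y z
  have hp := Real.pi_gt_three
  have h3 : |8 / Real.pi * deviation x y z| < 1 := by
    rw [abs_mul, abs_of_pos (by positivity)]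
    have : 8 / Real.pi ≤ 3 := by rw [div_le_iff₀ Real.pi_pos]; linarith
    calc 8 / Real.pi * |deviation x y z| ≤ 3 * (1 / 100) := by gcongr
      _ < 1 := by norm_num
  rw [abs_lt] at h3
  have a1 := Int.floor_le (direction x y - s)
  have a2 := Int.lt_floor_add_one (direction x y - s)
  have b1 := Int.floor_le (direction x z - s)
  have b2 := Int.lt_floor_add_one (direction x z - s)
  have c1 : (-2 : ℝ) < ((⌊direction x y - s⌋ - ⌊direction x z - s⌋ - 4 * quarter x y z : ℤ) : ℝ) := by
    push_cast; linarith
  have c2 : ((⌊direction x y - s⌋ - ⌊direction x z - s⌋ - 4 * quarter x y z : ℤ) : ℝ) < 2 := by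
    push_cast; linarith
  have c1' : (-2 : ℤ) < ⌊direction x y - s⌋ - ⌊direction x z - s⌋ - 4 * quarter x y z := by
    exact_mod_cast c1
  have c2' : ⌊direction x y - s⌋ - ⌊direction x z - s⌋ - 4 * quarter x y z < 2 := by
    exact_mod_cast c2
  omega

end Regular

open Classical in
/-- A reference particle among the neighbors of `x`. -/
def reference (r₀ : ℝ) (C : Finset ℂ) (x : ℂ) : ℂ :=
  if h : ∃ y, y ∈ neighbors r₀ C x then h.choose else x

open Classical in
/-- The axis at `x` to which the bond with `y` belongs. -/
def axisOf (r₀ : ℝ) (C : Finset ℂ) (x y : ℂ) : Bool :=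
  decide (quarter x y (reference r₀ C x) % 2 = 0)

open Classical in
/-- The sector of a slot. -/
def slotSector (r₀ : ℝ) (C : Finset ℂ) (s : ℝ) (a : ℂ × Bool) : ℤ :=
  if h : ∃ y, y ∈ neighbors r₀ C a.1 ∧ axisOf r₀ C a.1 y = a.2 then ⌊direction a.1 h.choose - s⌋
  else if h' : ∃ y, y ∈ neighbors r₀ C a.1 ∧ axisOf r₀ C a.1 y = !a.2 then
    ⌊direction a.1 h'.choose - s⌋ + 4
  else cond a.2 4 0

theorem reference_mem {r₀ : ℝ} {C : Finset ℂ} {x y : ℂ} (h : y ∈ neighbors r₀ C x) :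
    reference r₀ C x ∈ neighbors r₀ C x := by
  have h' : ∃ y, y ∈ neighbors r₀ C x := ⟨y, h⟩
  rw [reference, dif_pos h']
  exact h'.choose_spec

theorem axisOf_eq_iff {r₀ : ℝ} {C : Finset ℂ} (hC : RegularAngles r₀ C) {x : ℂ} (hx : x ∈ C)
    {y z : ℂ} (hy : y ∈ neighbors r₀ C x) (hz : z ∈ neighbors r₀ C x) :
    axisOf r₀ C x y = axisOf r₀ C x z ↔ quarter x y z % 2 = 0 := by
  have h := quarter_add hC hx hy hz (reference_mem hy)
  rw [axisOf, axisOf, decide_eq_decide]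
  omega

/-- Occupied slots get the sector of one of their bonds, and bonds on different axes differ by an
odd number of right angles, that is 4 ± 1 sectors modulo 8. The default values of empty slots are
chosen to differ by exactly 4. -/
theorem slotSector_perp {r₀ : ℝ} {C : Finset ℂ} (hC : RegularAngles r₀ C) (s : ℝ) (x : ℂ)
    (hx : x ∈ C) :
    3 ≤ (slotSector r₀ C s (x, true) - slotSector r₀ C s (x, false)) % 8 ∧
      (slotSector r₀ C s (x, true) - slotSector r₀ C s (x, false)) % 8 ≤ 5 := by
  by_cases h1 : ∃ y, y ∈ neighbors r₀ C x ∧ axisOf r₀ C x y = true <;>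
  by_cases h2 : ∃ y, y ∈ neighbors r₀ C x ∧ axisOf r₀ C x y = false
  · rw [slotSector, dif_pos h1, slotSector, dif_pos h2]
    have ht := h1.choose_spec
    have hf := h2.choose_spec
    have h3 := floor_direction_sub hC hx s ht.1 hf.1
    have h4 := axisOf_eq_iff hC hx ht.1 hf.1
    rw [ht.2, hf.2] at h4
    have h5 : ¬ quarter x h1.choose h2.choose % 2 = 0 := fun h => by simpa using h4.2 h
    simp only
    omega
  · simp only [slotSector, dif_pos h1, dif_neg h2, Bool.not_false]
    omega
  · simp only [slotSector, dif_pos h2, dif_neg h1, Bool.not_true]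
    omega
  · simp only [slotSector, dif_neg h1, dif_neg h2, Bool.not_true, Bool.not_false]
    simp

/-- The chain decomposition of a configuration with regular bond angles. -/
def chainSystem {r₀ : ℝ} {C : Finset ℂ} (hC : RegularAngles r₀ C) (s : ℝ) : ChainSystem C where
  s := s
  N := neighbors r₀ C
  axis := axisOf r₀ C
  F x y := ⌊direction x y - s⌋
  σ := slotSector r₀ C s
  mem_N h := (mem_neighbors.1 h).2.1
  symm hx h := neighbors_symm hx h
  rev {x y} hx h := by
    obtain ⟨k, hk⟩ := exists_direction_swap (mem_neighbors.1 h).1.symm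
    rw [hk, add_sub_right_comm, Int.floor_add_intCast]
    omega
  opp {x y z} hx hy hz hne hax _ h := by
    -- Two bonds on one axis differ by an even number of right angles that is not 0 modulo 4, so
    -- their sectors differ by 8 up to an error of 1 and cannot agree modulo 16.
    have h1 := (axisOf_eq_iff hC hx hy hz).1 hax
    have h2 := (hC x hx y hy z hz hne).2
    have h3 := floor_direction_sub hC hx s hy hz
    omega
  perp x hx := slotSector_perp hC s x hx
  cone {x y} hx h := inCone_floor s (sub_ne_zero.2 (mem_neighbors.1 h).1)

/-- The bond angles that are close to a straight angle. -/
def straightAngles (r₀ : ℝ) (C : Finset ℂ) : Finset (Σ _ : ℂ, Σ _ : ℂ, ℂ) :=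
  (C.sigma fun x => (neighbors r₀ C x).sigma fun y => (neighbors r₀ C x).erase y).filter
    fun t => quarter t.1 t.2.1 t.2.2 % 4 = 2

theorem mem_straightAngles {r₀ : ℝ} {C : Finset ℂ} {x y z : ℂ} :
    (⟨x, y, z⟩ : Σ _ : ℂ, Σ _ : ℂ, ℂ) ∈ straightAngles r₀ C ↔ x ∈ C ∧ y ∈ neighbors r₀ C x ∧
      z ∈ neighbors r₀ C x ∧ z ≠ y ∧ quarter x y z % 4 = 2 := by
  simp only [straightAngles, Finset.mem_filter, Finset.mem_sigma, Finset.mem_erase]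
  tauto

theorem card_badDarts_le {r₀ : ℝ} {C : Finset ℂ} (hC : RegularAngles r₀ C) (s : ℝ) :
    (chainSystem hC s).badDarts.card ≤ ((straightAngles r₀ C).filter fun t =>
      ⌊direction t.1 t.2.1 - s⌋ ≠
        ⌊direction t.1 t.2.2 + 4 * quarter t.1 t.2.1 t.2.2 - s⌋).card := by
  classical
  have hrep : ∀ x y, x ∈ C → y ∈ neighbors r₀ C x → ∃ z, z ∈ neighbors r₀ C x ∧
      axisOf r₀ C x z = axisOf r₀ C x y ∧
      slotSector r₀ C s (x, axisOf r₀ C x y) = ⌊direction x z - s⌋ := by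
    intro x y hx hy
    have h : ∃ z, z ∈ neighbors r₀ C x ∧ axisOf r₀ C x z = axisOf r₀ C x y := ⟨y, hy, rfl⟩
    refine ⟨h.choose, h.choose_spec.1, h.choose_spec.2, ?_⟩
    rw [slotSector, dif_pos h]
  choose! rep hrep1 hrep2 hrep3 using hrep
  -- A bad dart is matched with the straight angle that it forms with the bond from which its slot
  -- took its sector.
  refine Finset.card_le_card_of_injOn (fun p => ⟨p.1, p.2, rep p.1 p.2⟩) ?_ ?_
  · intro p hp
    obtain ⟨hd, hp⟩ := Finset.mem_filter.1 (Finset.mem_coe.1 hp)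
    obtain ⟨hx, hy⟩ := ChainSystem.mem_darts.1 hd
    have hy : p.2 ∈ neighbors r₀ C p.1 := hy
    have hp : ⌊direction p.1 p.2 - s⌋ % 8 ≠
      slotSector r₀ C s (p.1, axisOf r₀ C p.1 p.2) % 8 := hp
    rw [hrep3 _ _ hx hy] at hp
    have hz := hrep1 _ _ hx hy
    have hne : rep p.1 p.2 ≠ p.2 := fun h => hp (by rw [h])
    have hq := (axisOf_eq_iff hC hx hy hz).1 (hrep2 _ _ hx hy).symm
    have hq' := (hC p.1 hx p.2 hy _ hz hne.symm).2
    refine Finset.mem_coe.2 (Finset.mem_filter.2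
      ⟨mem_straightAngles.2 ⟨hx, hy, hz, hne, by omega⟩, ?_⟩)
    -- For a straight angle, 4 * `quarter` is a multiple of 8, so sectors that differ modulo 8 still
    -- differ after this shift.
    have e : direction p.1 (rep p.1 p.2) + 4 * quarter p.1 p.2 (rep p.1 p.2) - s =
        (direction p.1 (rep p.1 p.2) - s) + (4 * quarter p.1 p.2 (rep p.1 p.2) : ℤ) := by
      push_cast; ring
    simp only [e, Int.floor_add_intCast]
    omega
  · intro p _ q _ h
    simp only [Sigma.mk.injEq, heq_eq_eq] at h
    exact Prod.ext h.1 h.2.1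

/-- A configuration with regular bond angles decomposes into a number of chains that satisfies the
isoperimetric inequality. -/
theorem exists_chain_number {r₀ : ℝ} {C : Finset ℂ} (hC : RegularAngles r₀ C) :
    ∃ R : ℕ, 4 * C.card ≤ R ^ 2 ∧ 2 * (R : ℝ) + ∑ x ∈ C, ((neighbors r₀ C x).card : ℝ) ≤
      4 * C.card + 2 * ∑ t ∈ straightAngles r₀ C,
        8 / Real.pi * |deviation t.1 t.2.1 t.2.2| := by
  obtain ⟨s, hs⟩ := exists_shift (straightAngles r₀ C) (fun t => direction t.1 t.2.1)
    (fun t => direction t.1 t.2.2 + 4 * quarter t.1 t.2.1 t.2.2)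
  refine ⟨(chainSystem hC s).roots.card, (chainSystem hC s).four_mul_card_le, ?_⟩
  have h1 := (chainSystem hC s).two_mul_card_roots_add_le
  have h2 := card_badDarts_le hC s
  have h3 : (chainSystem hC s).darts.card = ∑ x ∈ C, (neighbors r₀ C x).card := by
    rw [ChainSystem.darts, Finset.card_filter, Finset.sum_product]
    refine Finset.sum_congr rfl fun x _ => ?_
    rw [← Finset.card_filter]
    congr 1
    ext y
    rw [Finset.mem_filter]
    exact ⟨fun h => h.2, fun h => ⟨(mem_neighbors.1 h).2.1, h⟩⟩
  have h4 : ∑ t ∈ straightAngles r₀ C, |direction t.1 t.2.1 -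
      (direction t.1 t.2.2 + 4 * quarter t.1 t.2.1 t.2.2)| =
      ∑ t ∈ straightAngles r₀ C, 8 / Real.pi * |deviation t.1 t.2.1 t.2.2| := by
    refine Finset.sum_congr rfl fun t _ => ?_
    have := direction_sub t.1 t.2.1 t.2.2
    have hpos : 0 < 8 / Real.pi := by positivity
    conv_rhs => rw [← abs_of_pos hpos]
    rw [← abs_mul]
    congr 1
    linarith
  rw [h4] at hs
  rw [h3] at h1
  have h1' : 2 * ((chainSystem hC s).roots.card : ℝ) + ∑ x ∈ C, ((neighbors r₀ C x).card : ℝ) ≤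
      4 * C.card + 2 * (chainSystem hC s).badDarts.card := by exact_mod_cast h1
  have h2' : ((chainSystem hC s).badDarts.card : ℝ) ≤ _ := Nat.cast_le.2 h2
  linarith

/-! ### The energy as a real number -/

/-- The sum of the angle energies at `x`, over ordered pairs of bonds. -/
def angleEnergy (r₀ : ℝ) (v₃ : ℝ → ℝ) (C : Finset ℂ) (x : ℂ) : ℝ :=
  ∑ y ∈ neighbors r₀ C x, ∑ z ∈ (neighbors r₀ C x).erase y, v₃ (cwAngle (y - x) (z - x))

/-- The real-valued version of the energy. -/
def realEnergy (r₀ : ℝ) (v₂ : ℝ → EReal) (v₃ : ℝ → ℝ) (C : Finset ℂ) : ℝ :=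
  ∑ x ∈ C, (1 / 2 * ∑ y ∈ C.erase x, (v₂ (dist x y)).toReal + 1 / 2 * angleEnergy r₀ v₃ C x)

/-- No two particles have infinite interaction energy. -/
def FinitePairs (v₂ : ℝ → EReal) (C : Finset ℂ) : Prop :=
  ∀ x ∈ C, ∀ y ∈ C, x ≠ y → v₂ (dist x y) ≠ ⊤

theorem ereal_coe_sum {ι : Type*} (s : Finset ι) (f : ι → ℝ) :
    ((∑ i ∈ s, f i : ℝ) : EReal) = ∑ i ∈ s, (f i : EReal) := by
  classical
  induction s using Finset.induction_on with
  | empty => simp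
  | insert a s ha ih => rw [Finset.sum_insert ha, Finset.sum_insert ha, EReal.coe_add, ih]

theorem ereal_sum_ne_bot {ι : Type*} (s : Finset ι) (f : ι → EReal)
    (h : ∀ i ∈ s, f i ≠ ⊥) : ∑ i ∈ s, f i ≠ ⊥ := by
  classical
  induction s using Finset.induction_on with
  | empty => simp
  | insert a s ha ih =>
    rw [Finset.sum_insert ha, Ne, EReal.add_eq_bot_iff, not_or]
    exact ⟨h a (Finset.mem_insert_self _ _), ih fun i hi => h i (Finset.mem_insert_of_mem hi)⟩

theorem ereal_ne_top_of_sum_ne_top {ι : Type*} (s : Finset ι) (f : ι → EReal)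
    (h : ∀ i ∈ s, f i ≠ ⊥) (hs : ∑ i ∈ s, f i ≠ ⊤) : ∀ i ∈ s, f i ≠ ⊤ := by
  classical
  intro i hi htop
  apply hs
  rw [← Finset.add_sum_erase _ _ hi, htop]
  exact EReal.top_add_of_ne_bot (ereal_sum_ne_bot _ _ fun j hj => h j (Finset.mem_of_mem_erase hj))

theorem cwAngle_mem (u w : ℂ) : cwAngle u w ∈ Set.Ico 0 (2 * Real.pi) := by
  have := toIcoMod_mem_Ico Real.two_pi_pos 0 (Complex.arg (u / w))
  rwa [zero_add] at this

section

variable {ε r₀ : ℝ} {v₂ : ℝ → EReal} {v₃ : ℝ → ℝ} (H : Admissible ε r₀ v₂ v₃)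
include H

theorem v₂_ne_bot {r : ℝ} (hr : 0 ≤ r) : v₂ r ≠ ⊥ := by
  intro h
  by_cases h1 : r = 1
  · rw [h1, H.value_one₂] at h
    exact absurd h (by decide)
  · have := H.min₂ r hr h1
    rw [h] at this
    exact not_lt_bot this

theorem neg_one_le_toReal {r : ℝ} (hr : 0 ≤ r) (ht : v₂ r ≠ ⊤) : -1 ≤ (v₂ r).toReal := by
  by_cases h1 : r = 1
  · rw [h1, H.value_one₂]; simp
  · have := H.min₂ r hr h1
    rw [← EReal.coe_toReal ht (v₂_ne_bot H hr)] at this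
    have h2 : ((-1 : ℝ) : EReal) < ((v₂ r).toReal : EReal) := by simpa using this
    exact (EReal.coe_lt_coe_iff.1 h2).le

theorem eq_one_of_toReal_eq {r : ℝ} (hr : 0 ≤ r) (ht : v₂ r ≠ ⊤) (h : (v₂ r).toReal = -1) :
    r = 1 := by
  by_contra h1
  have := H.min₂ r hr h1
  rw [← EReal.coe_toReal ht (v₂_ne_bot H hr), h] at this
  simp at this

theorem toReal_eq_zero {r : ℝ} (hr : r₀ ≤ r) : (v₂ r).toReal = 0 := by
  rw [H.cutoff₂ r hr]; simp

theorem energy_eq_coe {C : Finset ℂ} (hC : FinitePairs v₂ C) :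
    energy r₀ v₂ v₃ C = (realEnergy r₀ v₂ v₃ C : EReal) := by
  have h1 : ∑ x ∈ C, ∑ y ∈ C.erase x, v₂ (dist x y) =
      ((∑ x ∈ C, ∑ y ∈ C.erase x, (v₂ (dist x y)).toReal : ℝ) : EReal) := by
    rw [ereal_coe_sum]
    refine Finset.sum_congr rfl fun x hx => ?_
    rw [ereal_coe_sum]
    refine Finset.sum_congr rfl fun y hy => ?_
    rw [EReal.coe_toReal (hC x hx y (Finset.mem_of_mem_erase hy) (Finset.ne_of_mem_erase hy).symm)
      (v₂_ne_bot H dist_nonneg)]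
  rw [energy, h1, ← EReal.coe_mul, ← EReal.coe_add, realEnergy, Finset.sum_add_distrib,
    ← Finset.mul_sum, ← Finset.mul_sum]
  rfl

theorem finitePairs_of_energy_ne_top {C : Finset ℂ} (hC : energy r₀ v₂ v₃ C ≠ ⊤) :
    FinitePairs v₂ C := by
  have h0 : ∀ x ∈ C, ∑ y ∈ C.erase x, v₂ (dist x y) ≠ ⊥ := fun x _ =>
    ereal_sum_ne_bot _ _ fun y _ => v₂_ne_bot H dist_nonneg
  have h1 : ∑ x ∈ C, ∑ y ∈ C.erase x, v₂ (dist x y) ≠ ⊤ := by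
    intro h
    apply hC
    rw [energy, h, EReal.coe_mul_top_of_pos (by norm_num)]
    exact EReal.top_add_coe _
  intro x hx y hy hxy
  have h2 := ereal_ne_top_of_sum_ne_top _ _ h0 h1 x hx
  exact ereal_ne_top_of_sum_ne_top _ _ (fun y _ => v₂_ne_bot H dist_nonneg) h2 y
    (Finset.mem_erase.2 ⟨hxy.symm, hy⟩)

theorem v₃_nonneg (u w : ℂ) : 0 ≤ v₃ (cwAngle u w) := by
  have h := cwAngle_mem u w
  by_cases h1 : cwAngle u w = Real.pi / 2
  · rw [h1, H.zero₃.1]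
  by_cases h2 : cwAngle u w = Real.pi
  · rw [h2, H.zero₃.2.1]
  by_cases h3 : cwAngle u w = 3 * Real.pi / 2
  · rw [h3, H.zero₃.2.2]
  exact (H.pos₃ _ ⟨h.1, h.2.le⟩ h1 h2 h3).le

theorem angleEnergy_nonneg (C : Finset ℂ) (x : ℂ) : 0 ≤ angleEnergy r₀ v₃ C x :=
  Finset.sum_nonneg fun _ _ => Finset.sum_nonneg fun _ _ => v₃_nonneg H _ _

theorem angleEnergy_mono {A C : Finset ℂ} (h : A ⊆ C) (x : ℂ) :
    angleEnergy r₀ v₃ A x ≤ angleEnergy r₀ v₃ C x := by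
  have hN : neighbors r₀ A x ⊆ neighbors r₀ C x :=
    Finset.filter_subset_filter _ (Finset.erase_subset_erase _ h)
  refine (Finset.sum_le_sum fun y _ => Finset.sum_le_sum_of_subset_of_nonneg
    (Finset.erase_subset_erase _ hN) fun z _ _ => v₃_nonneg H _ _).trans ?_
  exact Finset.sum_le_sum_of_subset_of_nonneg hN fun y _ _ =>
    Finset.sum_nonneg fun _ _ => v₃_nonneg H _ _

theorem realEnergy_union {A B : Finset ℂ} (hAB : ∀ x ∈ A, ∀ y ∈ B, r₀ < dist x y) :
    realEnergy r₀ v₂ v₃ (A ∪ B) = realEnergy r₀ v₂ v₃ A + realEnergy r₀ v₂ v₃ B := by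
  have hr := zero_lt_one.trans H.one_lt_r₀
  have hdisj : Disjoint A B := by
    rw [Finset.disjoint_left]
    intro x hA hB
    have := hAB x hA x hB
    rw [dist_self] at this
    linarith
  have key : ∀ A B : Finset ℂ, (∀ x ∈ A, ∀ y ∈ B, r₀ < dist x y) → Disjoint A B → ∀ x ∈ A,
      (1 / 2 * ∑ y ∈ (A ∪ B).erase x, (v₂ (dist x y)).toReal +
        1 / 2 * angleEnergy r₀ v₃ (A ∪ B) x) =
      (1 / 2 * ∑ y ∈ A.erase x, (v₂ (dist x y)).toReal + 1 / 2 * angleEnergy r₀ v₃ A x) := by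
    intro A B hAB hdisj x hx
    have hxB : x ∉ B := Finset.disjoint_left.1 hdisj hx
    have e1 : (A ∪ B).erase x = A.erase x ∪ B := by
      rw [Finset.erase_union_distrib, Finset.erase_eq_of_notMem hxB]
    have e2 : neighbors r₀ (A ∪ B) x = neighbors r₀ A x := by
      ext y
      simp only [mem_neighbors, Finset.mem_union]
      constructor
      · rintro ⟨h1, h2 | h2, h3⟩
        · exact ⟨h1, h2, h3⟩
        · exact absurd h3 (not_le.2 (hAB x hx y h2))
      · rintro ⟨h1, h2, h3⟩
        exact ⟨h1, Or.inl h2, h3⟩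
    rw [angleEnergy, angleEnergy, e1, e2, Finset.sum_union
      (Finset.disjoint_of_subset_left (Finset.erase_subset _ _) hdisj),
      Finset.sum_eq_zero (s := B) fun y hy => toReal_eq_zero H (hAB x hx y hy).le, add_zero]
  rw [realEnergy, Finset.sum_union hdisj, Finset.sum_congr rfl (key A B hAB hdisj),
    Finset.union_comm A B, Finset.sum_congr rfl (key B A (fun x hx y hy => by
      rw [dist_comm]; exact hAB y hy x hx) hdisj.symm)]
  rfl

/-- Only an inequality holds, since the new particle may also create angles at the others; their
energy is nonnegative and is dropped. -/
theorem realEnergy_insert_ge {A : Finset ℂ} {x : ℂ} (hx : x ∉ A) :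
    realEnergy r₀ v₂ v₃ A + ∑ y ∈ A, (v₂ (dist x y)).toReal +
      1 / 2 * angleEnergy r₀ v₃ (insert x A) x ≤ realEnergy r₀ v₂ v₃ (insert x A) := by
  rw [realEnergy, realEnergy, Finset.sum_insert hx, Finset.erase_insert hx]
  have h1 : ∀ x' ∈ A, (1 / 2 * ∑ y ∈ A.erase x', (v₂ (dist x' y)).toReal +
      1 / 2 * angleEnergy r₀ v₃ A x') + 1 / 2 * (v₂ (dist x x')).toReal ≤
      (1 / 2 * ∑ y ∈ (insert x A).erase x', (v₂ (dist x' y)).toReal +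
      1 / 2 * angleEnergy r₀ v₃ (insert x A) x') := by
    intro x' hx'
    have hne : x ≠ x' := fun h => hx (h ▸ hx')
    rw [Finset.erase_insert_of_ne hne,
      Finset.sum_insert fun h => hx (Finset.mem_of_mem_erase h), dist_comm x' x]
    have := angleEnergy_mono H (r₀ := r₀) (Finset.subset_insert x A) x'
    linarith
  have h2 := Finset.sum_le_sum h1
  rw [Finset.sum_add_distrib, ← Finset.mul_sum] at h2
  linarith

end

/-! ### Lattice configurations as competitors -/

/-- The embedding of the square lattice into the plane. -/
def latticePoint (k : ℤ × ℤ) : ℂ := ⟨(k.1 : ℝ), (k.2 : ℝ)⟩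

theorem latticePoint_injective : Function.Injective latticePoint := by
  intro p q h
  have h1 := congrArg Complex.re h
  have h2 := congrArg Complex.im h
  simp only [latticePoint, Int.cast_inj] at h1 h2
  exact Prod.ext h1 h2

theorem latticePoint_sub (p q : ℤ × ℤ) : latticePoint p - latticePoint q = latticePoint (p - q) := by
  apply Complex.ext <;> simp [latticePoint]

theorem dist_latticePoint_sq (p q : ℤ × ℤ) :
    dist (latticePoint p) (latticePoint q) ^ 2 = (((p.1 - q.1) ^ 2 + (p.2 - q.2) ^ 2 : ℤ) : ℝ) := by
  rw [Complex.dist_eq, latticePoint_sub, Complex.sq_norm, Complex.normSq_apply, latticePoint]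
  simp only [Prod.fst_sub, Prod.snd_sub]
  push_cast
  ring

theorem latticePoint_dist_cases {p q : ℤ × ℤ} (h : p ≠ q) :
    (dist (latticePoint p) (latticePoint q) = 1 ∧ (p.1 - q.1) ^ 2 + (p.2 - q.2) ^ 2 = 1) ∨
      Real.sqrt 2 ≤ dist (latticePoint p) (latticePoint q) := by
  have h1 := dist_latticePoint_sq p q
  have h2 : 1 ≤ (p.1 - q.1) ^ 2 + (p.2 - q.2) ^ 2 := by
    by_contra hlt
    apply h
    have e1 : p.1 - q.1 = 0 := by nlinarith [sq_nonneg (p.1 - q.1), sq_nonneg (p.2 - q.2)]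
    have e2 : p.2 - q.2 = 0 := by nlinarith [sq_nonneg (p.1 - q.1), sq_nonneg (p.2 - q.2)]
    exact Prod.ext (by omega) (by omega)
  rcases h2.eq_or_lt with h3 | h3
  · left
    refine ⟨?_, h3.symm⟩
    rw [← h3, Int.cast_one] at h1
    nlinarith [dist_nonneg (x := latticePoint p) (y := latticePoint q)]
  · right
    apply Real.sqrt_le_iff.2
    refine ⟨dist_nonneg, ?_⟩
    rw [h1]
    have : (2 : ℤ) ≤ (p.1 - q.1) ^ 2 + (p.2 - q.2) ^ 2 := by omega
    exact_mod_cast this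

/-- The four neighbors of a lattice point. -/
def unitSteps : Finset (ℤ × ℤ) := {(1, 0), (-1, 0), (0, 1), (0, -1)}

theorem mem_unitSteps {e : ℤ × ℤ} : e ∈ unitSteps ↔ e.1 ^ 2 + e.2 ^ 2 = 1 := by
  obtain ⟨a, b⟩ := e
  simp only [unitSteps, Finset.mem_insert, Finset.mem_singleton, Prod.mk.injEq]
  constructor
  · rintro (⟨rfl, rfl⟩ | ⟨rfl, rfl⟩ | ⟨rfl, rfl⟩ | ⟨rfl, rfl⟩) <;> norm_num
  · intro h
    have h1 : -1 ≤ a := by nlinarith [sq_nonneg b]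
    have h2 : a ≤ 1 := by nlinarith [sq_nonneg b]
    have h3 : -1 ≤ b := by nlinarith [sq_nonneg a]
    have h4 : b ≤ 1 := by nlinarith [sq_nonneg a]
    interval_cases a <;> interval_cases b <;> simp_all

theorem latticePoint_pow_four {e : ℤ × ℤ} (he : e ∈ unitSteps) : latticePoint e ^ 4 = 1 := by
  have key : ∀ a b : ℤ, latticePoint (a, b) = a + b * Complex.I := by
    intro a b; apply Complex.ext <;> simp [latticePoint]
  have hI : Complex.I ^ 4 = 1 := Complex.I_pow_four
  simp only [unitSteps, Finset.mem_insert, Finset.mem_singleton] at he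
  rcases he with rfl | rfl | rfl | rfl <;> rw [key] <;> push_cast <;> ring_nf <;> simp [hI]

theorem eq_of_pow_four_eq_one {q : ℂ} (h : q ^ 4 = 1) :
    q = 1 ∨ q = -1 ∨ q = Complex.I ∨ q = -Complex.I := by
  have hI : Complex.I ^ 2 = -1 := Complex.I_sq
  have : (q - 1) * ((q + 1) * ((q - Complex.I) * (q + Complex.I))) = 0 := by
    linear_combination h - (q ^ 2 - 1) * hI
  rcases mul_eq_zero.1 this with h | h
  · exact Or.inl (sub_eq_zero.1 h)
  rcases mul_eq_zero.1 h with h | h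
  · exact Or.inr (Or.inl (eq_neg_of_add_eq_zero_left h))
  rcases mul_eq_zero.1 h with h | h
  · exact Or.inr (Or.inr (Or.inl (sub_eq_zero.1 h)))
  · exact Or.inr (Or.inr (Or.inr (eq_neg_of_add_eq_zero_left h)))

theorem cwAngle_of_div_pow_four {u w : ℂ} (h : (u / w) ^ 4 = 1) (hne : u / w ≠ 1) :
    cwAngle u w = Real.pi / 2 ∨ cwAngle u w = Real.pi ∨ cwAngle u w = 3 * Real.pi / 2 := by
  have hp := Real.pi_pos
  rcases eq_of_pow_four_eq_one h with h | h | h | h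
  · exact absurd h hne
  · right; left
    rw [cwAngle, h, Complex.arg_neg_one, toIcoMod_eq_self]
    constructor <;> linarith
  · left
    rw [cwAngle, h, Complex.arg_I, toIcoMod_eq_self]
    constructor <;> linarith
  · right; right
    rw [cwAngle, h, Complex.arg_neg_I, ← toIcoMod_add_right Real.two_pi_pos,
      (toIcoMod_eq_self _).2]
    · ring
    · constructor <;> linarith

theorem card_filter_add_mem (P : Finset (ℤ × ℤ)) (e : ℤ × ℤ) :
    (P.filter fun p => p + e ∈ P).card = (P.filter fun p => p + -e ∈ P).card := by
  refine Finset.card_bij (fun p _ => p + e) ?_ ?_ ?_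
  · intro p hp
    obtain ⟨h1, h2⟩ := Finset.mem_filter.1 hp
    exact Finset.mem_filter.2 ⟨h2, by rwa [add_neg_cancel_right]⟩
  · intro p _ q _ h
    exact add_right_cancel h
  · intro q hq
    obtain ⟨h1, h2⟩ := Finset.mem_filter.1 hq
    exact ⟨q + -e, Finset.mem_filter.2 ⟨h2, by rwa [neg_add_cancel_right]⟩,
      neg_add_cancel_right _ _⟩

/-- The number of ordered bonds of a lattice configuration. -/
theorem sum_card_unitSteps (P : Finset (ℤ × ℤ)) :
    ∑ p ∈ P, (unitSteps.filter fun e => p + e ∈ P).card =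
      2 * ((P.filter fun p => p + (-1, 0) ∈ P).card + (P.filter fun p => p + (0, -1) ∈ P).card) := by
  have h1 : ∑ p ∈ P, (unitSteps.filter fun e => p + e ∈ P).card =
      ∑ e ∈ unitSteps, (P.filter fun p => p + e ∈ P).card := by
    simp_rw [Finset.card_filter]
    exact Finset.sum_comm
  have h2 := card_filter_add_mem P (1, 0)
  have h3 := card_filter_add_mem P (0, 1)
  simp only [Prod.neg_mk, neg_zero] at h2 h3
  rw [h1, unitSteps, Finset.sum_insert (by decide), Finset.sum_insert (by decide),
    Finset.sum_insert (by decide), Finset.sum_singleton, h2, h3]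
  ring

/-- `n` lattice points arranged in consecutive rows of length `b`. -/
def rowFilling (n b : ℕ) : Finset (ℤ × ℤ) :=
  (Finset.range n).image fun k => (((k % b : ℕ) : ℤ), ((k / b : ℕ) : ℤ))

theorem card_rowFilling (n b : ℕ) : (rowFilling n b).card = n := by
  rw [rowFilling, Finset.card_image_of_injective, Finset.card_range]
  intro k l h
  simp only [Prod.mk.injEq, Nat.cast_inj] at h
  rw [← Nat.div_add_mod k b, ← Nat.div_add_mod l b, h.1, h.2]

/-- Only points of the first column, one in each of at most a rows, lack a left neighbor, and only
the first b points lack one below. -/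
theorem bonds_rowFilling {n a b : ℕ} (hb : 0 < b) (h : n ≤ a * b) :
    2 * n ≤ ((rowFilling n b).filter fun p => p + (-1, 0) ∈ rowFilling n b).card +
      ((rowFilling n b).filter fun p => p + (0, -1) ∈ rowFilling n b).card + (a + b) := by
  set P := rowFilling n b with hP
  have c1 : (P.filter fun p => p + (-1, 0) ∈ P).card + (P.filter fun p => ¬ p + (-1, 0) ∈ P).card
    = P.card := Finset.card_filter_add_card_filter_not _
  have c2 : (P.filter fun p => p + (0, -1) ∈ P).card + (P.filter fun p => ¬ p + (0, -1) ∈ P).card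
    = P.card := Finset.card_filter_add_card_filter_not _
  have hcard : P.card = n := card_rowFilling n b
  have d1 : (P.filter fun p => ¬ p + (-1, 0) ∈ P).card ≤ a := by
    have : (P.filter fun p => ¬ p + (-1, 0) ∈ P) ⊆
        (Finset.range a).image fun j : ℕ => ((0 : ℤ), (j : ℤ)) := by
      intro p hp
      obtain ⟨hp, hn⟩ := Finset.mem_filter.1 hp
      obtain ⟨k, hk, rfl⟩ := Finset.mem_image.1 hp
      rw [Finset.mem_range] at hk
      have hk0 : k % b = 0 := by
        by_contra h0
        apply hn
        refine Finset.mem_image.2 ⟨k - 1, Finset.mem_range.2 (by omega), ?_⟩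
        have e : k - 1 = b * (k / b) + (k % b - 1) := by
          have := Nat.div_add_mod k b
          omega
        have hlt : k % b - 1 < b := by
          have := Nat.mod_lt k hb
          omega
        have e1 : (k - 1) % b = k % b - 1 := by
          rw [e, Nat.mul_add_mod_self_left, Nat.mod_eq_of_lt hlt]
        have e2 : (k - 1) / b = k / b := by
          rw [e, Nat.mul_add_div hb, Nat.div_eq_of_lt hlt, add_zero]
        rw [e1, e2]
        refine Prod.ext ?_ ?_
        · simp only [Prod.fst_add]; omega
        · simp
      refine Finset.mem_image.2 ⟨k / b, Finset.mem_range.2 ?_, ?_⟩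
      · rw [Nat.div_lt_iff_lt_mul hb]; omega
      · simp only [hk0, Nat.cast_zero]
    refine (Finset.card_le_card this).trans (Finset.card_image_le.trans ?_)
    rw [Finset.card_range]
  have d2 : (P.filter fun p => ¬ p + (0, -1) ∈ P).card ≤ b := by
    have : (P.filter fun p => ¬ p + (0, -1) ∈ P) ⊆
        (Finset.range b).image fun j : ℕ => ((j : ℤ), (0 : ℤ)) := by
      intro p hp
      obtain ⟨hp, hn⟩ := Finset.mem_filter.1 hp
      obtain ⟨k, hk, rfl⟩ := Finset.mem_image.1 hp
      rw [Finset.mem_range] at hk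
      have hkb : k < b := by
        by_contra h0
        apply hn
        refine Finset.mem_image.2 ⟨k - b, Finset.mem_range.2 (by omega), ?_⟩
        have e : k = k - b + b := by omega
        have e1 : k % b = (k - b) % b := by rw [e, Nat.add_mod_right]; simp
        have e2 : k / b = (k - b) / b + 1 := by rw [← Nat.add_div_right _ hb, ← e]
        refine Prod.ext ?_ ?_
        · simp [e1]
        · simp [e2]
      refine Finset.mem_image.2 ⟨k, Finset.mem_range.2 hkb, ?_⟩
      rw [Nat.mod_eq_of_lt hkb, Nat.div_eq_of_lt hkb, Nat.cast_zero]
    refine (Finset.card_le_card this).trans (Finset.card_image_le.trans ?_)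
    rw [Finset.card_range]
  omega

section

variable {ε r₀ : ℝ} {v₂ : ℝ → EReal} {v₃ : ℝ → ℝ} (H : Admissible ε r₀ v₂ v₃)
include H

theorem finitePairs_lattice (P : Finset (ℤ × ℤ)) : FinitePairs v₂ (P.image latticePoint) := by
  intro x hx y hy hxy
  obtain ⟨p, -, rfl⟩ := Finset.mem_image.1 hx
  obtain ⟨q, -, rfl⟩ := Finset.mem_image.1 hy
  rcases latticePoint_dist_cases (fun h : p = q => hxy (by rw [h])) with h | h
  · rw [h.1, H.value_one₂]; decide
  · rw [H.cutoff₂ _ (H.r₀_lt.le.trans h)]; simp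

theorem angleEnergy_lattice (P : Finset (ℤ × ℤ)) {x : ℂ} (hx : x ∈ P.image latticePoint) :
    angleEnergy r₀ v₃ (P.image latticePoint) x = 0 := by
  obtain ⟨p, -, rfl⟩ := Finset.mem_image.1 hx
  have key : ∀ y ∈ neighbors r₀ (P.image latticePoint) (latticePoint p),
      (y - latticePoint p) ^ 4 = 1 := by
    intro y hy
    obtain ⟨hne, hy, hd⟩ := mem_neighbors.1 hy
    obtain ⟨q, -, rfl⟩ := Finset.mem_image.1 hy
    have hqp : q ≠ p := fun h => hne (by rw [h])
    rw [latticePoint_sub]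
    apply latticePoint_pow_four
    rw [mem_unitSteps]
    rcases latticePoint_dist_cases hqp with h | h
    · exact h.2
    · rw [dist_comm] at h
      exact absurd (h.trans hd) (not_le.2 H.r₀_lt)
  refine Finset.sum_eq_zero fun y hy => Finset.sum_eq_zero fun z hz => ?_
  have hyz := Finset.ne_of_mem_erase hz
  have h1 := key y hy
  have h2 := key z (Finset.mem_of_mem_erase hz)
  have hz0 : z - latticePoint p ≠ 0 := fun h => by simp [h] at h2
  have h3 : ((y - latticePoint p) / (z - latticePoint p)) ^ 4 = 1 := by rw [div_pow, h1, h2, div_one]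
  rcases cwAngle_of_div_pow_four h3 (fun h => hyz (by
    rw [div_eq_one_iff_eq hz0] at h
    exact (sub_left_injective h).symm)) with h | h | h
  · rw [h, H.zero₃.1]
  · rw [h, H.zero₃.2.1]
  · rw [h, H.zero₃.2.2]

/-- Lattice distances other than 1 are at least √2 > r₀ and contribute nothing, and all angles
between unit steps are free. -/
theorem realEnergy_lattice_le (P : Finset (ℤ × ℤ)) :
    realEnergy r₀ v₂ v₃ (P.image latticePoint) ≤
      -(((P.filter fun p => p + (-1, 0) ∈ P).card + (P.filter fun p => p + (0, -1) ∈ P).card : ℕ)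
        : ℝ) := by
  have hsite : ∀ p ∈ P, ∑ y ∈ (P.image latticePoint).erase (latticePoint p),
      (v₂ (dist (latticePoint p) y)).toReal ≤ -((unitSteps.filter fun e => p + e ∈ P).card : ℝ) := by
    intro p hp
    set E := (unitSteps.filter fun e => p + e ∈ P).image (fun e => latticePoint (p + e)) with hE
    have hcard : E.card = (unitSteps.filter fun e => p + e ∈ P).card :=
      Finset.card_image_of_injective _ (latticePoint_injective.comp (add_right_injective p))
    have hsub : E ⊆ (P.image latticePoint).erase (latticePoint p) := by
      intro y hy
      obtain ⟨e, he, rfl⟩ := Finset.mem_image.1 hy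
      obtain ⟨he, hpe⟩ := Finset.mem_filter.1 he
      refine Finset.mem_erase.2 ⟨fun h => ?_, Finset.mem_image_of_mem _ hpe⟩
      have := latticePoint_injective h
      rw [add_eq_left] at this
      rw [this, mem_unitSteps] at he
      simp at he
    have h1 : ∑ y ∈ (P.image latticePoint).erase (latticePoint p),
        (v₂ (dist (latticePoint p) y)).toReal ≤ ∑ y ∈ E, (v₂ (dist (latticePoint p) y)).toReal := by
      rw [← Finset.sum_sdiff hsub]
      have : ∑ y ∈ (P.image latticePoint).erase (latticePoint p) \ E,
        (v₂ (dist (latticePoint p) y)).toReal ≤ 0 := by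
        refine Finset.sum_nonpos fun y hy => ?_
        have hy := Finset.mem_erase.1 (Finset.mem_sdiff.1 hy).1
        obtain ⟨q, -, rfl⟩ := Finset.mem_image.1 hy.2
        rcases latticePoint_dist_cases (p := p) (q := q) (fun h => hy.1 (by rw [h])) with h | h
        · rw [h.1, H.value_one₂]; simp
        · rw [toReal_eq_zero H (H.r₀_lt.le.trans h)]
      linarith
    refine h1.trans (le_of_eq ?_)
    rw [← hcard, Finset.sum_congr rfl (g := fun _ => (-1 : ℝ))]
    · simp
    · intro y hy
      obtain ⟨e, he, rfl⟩ := Finset.mem_image.1 hy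
      have he := mem_unitSteps.1 (Finset.mem_filter.1 he).1
      have : dist (latticePoint p) (latticePoint (p + e)) ^ 2 = 1 := by
        rw [dist_latticePoint_sq]
        have : (p.1 - (p + e).1) ^ 2 + (p.2 - (p + e).2) ^ 2 = 1 := by
          rw [← he, Prod.fst_add, Prod.snd_add]; ring
        rw [this, Int.cast_one]
      rw [(pow_eq_one_iff_of_nonneg dist_nonneg two_ne_zero).1 this, H.value_one₂]
      simp
  have h2 := Finset.sum_le_sum hsite
  rw [Finset.sum_neg_distrib, ← Nat.cast_sum, sum_card_unitSteps] at h2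
  rw [realEnergy, Finset.sum_congr rfl fun x hx => by rw [angleEnergy_lattice H P hx],
    Finset.sum_image latticePoint_injective.injOn]
  simp only [mul_zero, add_zero]
  rw [← Finset.mul_sum]
  push_cast at h2 ⊢
  linarith

/-- A finite subset of the square lattice with few rows and columns as a competitor. -/
theorem exists_competitor {n R : ℕ} (hR : 4 * n ≤ R ^ 2) :
    ∃ D : Finset ℂ, D.card = n ∧ energy r₀ v₂ v₃ D ≤ ((R - 2 * n : ℝ) : EReal) := by
  -- The halves of R, rounded down and up, have product ⌊R²/4⌋, which is at least n.
  set a := R / 2 with ha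
  set b := R - R / 2 with hb'
  have hab : n ≤ a * b := by
    obtain ⟨m, hm | hm⟩ := Nat.even_or_odd' R
    · have e1 : a = m := by omega
      have e2 : b = m := by omega
      rw [e1, e2]; rw [hm] at hR; nlinarith
    · have e1 : a = m := by omega
      have e2 : b = m + 1 := by omega
      rw [e1, e2]; rw [hm] at hR; nlinarith
  rcases Nat.eq_zero_or_pos n with hn | hn
  · refine ⟨∅, by simp [hn], ?_⟩
    simp [energy, hn]
  have hb : 0 < b := by
    rcases Nat.eq_zero_or_pos b with h | h
    · rw [h] at hab; omega
    · exact h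
  refine ⟨(rowFilling n b).image latticePoint, ?_, ?_⟩
  · rw [Finset.card_image_of_injective _ latticePoint_injective, card_rowFilling]
  · rw [energy_eq_coe H (finitePairs_lattice H _), EReal.coe_le_coe_iff]
    refine (realEnergy_lattice_le H _).trans ?_
    have h1 := bonds_rowFilling hb hab
    have h2 : a + b = R := by omega
    rw [h2] at h1
    have h3 : (2 * n : ℝ) ≤ ((((rowFilling n b).filter fun p => p + (-1, 0) ∈ rowFilling n b).card +
      ((rowFilling n b).filter fun p => p + (0, -1) ∈ rowFilling n b).card : ℕ) : ℝ) + R := by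
      exact_mod_cast h1
    linarith

end

/-! ### Separation and bond angles in ground states -/

theorem exists_cwAngle_eq {u w : ℂ} (hu : u ≠ 0) (hw : w ≠ 0) :
    ∃ k : ℤ, cwAngle u w = Complex.arg u - Complex.arg w + 2 * Real.pi * k := by
  have h1 := Complex.arg_div_coe_angle hu hw
  rw [← Real.Angle.coe_sub, Real.Angle.angle_eq_iff_two_pi_dvd_sub] at h1
  obtain ⟨k, hk⟩ := h1
  refine ⟨k - toIcoDiv Real.two_pi_pos 0 (Complex.arg (u / w)), ?_⟩
  rw [cwAngle, toIcoMod, zsmul_eq_mul]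
  push_cast
  linarith

theorem cwAngle_swap {u w : ℂ} (hu : u ≠ 0) (hw : w ≠ 0) :
    (cwAngle u w = 0 ∧ cwAngle w u = 0) ∨ cwAngle w u = 2 * Real.pi - cwAngle u w := by
  obtain ⟨k, hk⟩ := exists_cwAngle_eq hu hw
  obtain ⟨l, hl⟩ := exists_cwAngle_eq hw hu
  have h1 := cwAngle_mem u w
  have h2 := cwAngle_mem w u
  have hp := Real.pi_pos
  have hsum : cwAngle u w + cwAngle w u = 2 * Real.pi * ((k + l : ℤ) : ℝ) := by
    rw [hk, hl]; push_cast; ring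
  have a1 : (0 : ℝ) ≤ ((k + l : ℤ) : ℝ) := by
    by_contra! h
    have := mul_neg_of_pos_of_neg Real.two_pi_pos h
    linarith [h1.1, h2.1]
  have a2 : ((k + l : ℤ) : ℝ) < 2 := by
    by_contra! h
    have := mul_le_mul_of_nonneg_left h Real.two_pi_pos.le
    linarith [h1.2, h2.2]
  have a1' : 0 ≤ k + l := by exact_mod_cast a1
  have a2' : k + l < 2 := by exact_mod_cast a2
  have : k + l = 0 ∨ k + l = 1 := by omega
  rcases this with h | h
  · rw [h, Int.cast_zero, mul_zero] at hsum
    left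
    constructor <;> linarith [h1.1, h2.1]
  · rw [h, Int.cast_one, mul_one] at hsum
    right; linarith

/-- All bond angles lie within `ε` of `π/2`, `π` or `3π/2`. -/
def GoodAngles (ε r₀ : ℝ) (C : Finset ℂ) : Prop :=
  ∀ x ∈ C, ∀ y ∈ neighbors r₀ C x, ∀ z ∈ neighbors r₀ C x, y ≠ z →
    cwAngle (y - x) (z - x) ∈ Set.Icc (Real.pi / 2 - ε) (Real.pi / 2 + ε) ∨
    cwAngle (y - x) (z - x) ∈ Set.Icc (Real.pi - ε) (Real.pi + ε) ∨
    cwAngle (y - x) (z - x) ∈ Set.Icc (3 * Real.pi / 2 - ε) (3 * Real.pi / 2 + ε)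

theorem neighbors_subset {r₀ : ℝ} {A C : Finset ℂ} (h : A ⊆ C) (x : ℂ) :
    neighbors r₀ A x ⊆ neighbors r₀ C x :=
  Finset.filter_subset_filter _ (Finset.erase_subset_erase _ h)

theorem GoodAngles.subset {ε r₀ : ℝ} {A C : Finset ℂ} (h : GoodAngles ε r₀ C) (hA : A ⊆ C) :
    GoodAngles ε r₀ A := fun x hx y hy z hz hyz =>
  h x (hA hx) y (neighbors_subset hA x hy) z (neighbors_subset hA x hz) hyz

theorem quarter_eq_of_abs_le {x y z : ℂ} {m : ℤ}
    (h : |turn x y z - m * (Real.pi / 2)| ≤ 1 / 100) : quarter x y z = m := by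
  have hp := Real.pi_gt_three
  rw [quarter, round_eq, Int.floor_eq_iff]
  have e : turn x y z / (Real.pi / 2) = m + (turn x y z - m * (Real.pi / 2)) / (Real.pi / 2) := by
    field_simp; ring
  have h2 : |(turn x y z - m * (Real.pi / 2)) / (Real.pi / 2)| < 1 / 2 := by
    rw [abs_div, abs_of_pos (by positivity : 0 < Real.pi / 2), div_lt_iff₀ (by positivity)]
    linarith
  rw [abs_lt] at h2
  rw [e]
  constructor <;> linarith

/-- A bond angle close to `j π / 2`, in terms of the multiple of a right angle it is close to. -/
theorem quarter_of_cwAngle {ε : ℝ} (hε : ε ≤ 1 / 100) {x y z : ℂ} (hy : y ≠ x) (hz : z ≠ x) {j : ℤ}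
    (h : |cwAngle (y - x) (z - x) - j * (Real.pi / 2)| ≤ ε) :
    quarter x y z % 4 = j % 4 ∧ deviation x y z = cwAngle (y - x) (z - x) - j * (Real.pi / 2) := by
  obtain ⟨k, hk⟩ := exists_cwAngle_eq (sub_ne_zero.2 hy) (sub_ne_zero.2 hz)
  have e : turn x y z - ((j - 4 * k : ℤ) : ℝ) * (Real.pi / 2) =
      cwAngle (y - x) (z - x) - j * (Real.pi / 2) := by
    rw [hk, turn]; push_cast; ring
  have hq : quarter x y z = j - 4 * k := quarter_eq_of_abs_le (by rw [e]; linarith)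
  refine ⟨by omega, ?_⟩
  rw [deviation, hq, e]

theorem GoodAngles.exists_index {ε r₀ : ℝ} {C : Finset ℂ} (h : GoodAngles ε r₀ C) {x y z : ℂ}
    (hx : x ∈ C) (hy : y ∈ neighbors r₀ C x) (hz : z ∈ neighbors r₀ C x) (hyz : y ≠ z) :
    ∃ j : ℤ, 1 ≤ j ∧ j ≤ 3 ∧ |cwAngle (y - x) (z - x) - j * (Real.pi / 2)| ≤ ε := by
  rcases h x hx y hy z hz hyz with h | h | h
  · refine ⟨1, by norm_num, by norm_num, abs_le.2 ?_⟩
    push_cast; constructor <;> linarith [h.1, h.2]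
  · refine ⟨2, by norm_num, by norm_num, abs_le.2 ?_⟩
    push_cast; constructor <;> linarith [h.1, h.2]
  · refine ⟨3, by norm_num, by norm_num, abs_le.2 ?_⟩
    push_cast; constructor <;> linarith [h.1, h.2]

theorem GoodAngles.regular {ε r₀ : ℝ} (hε : ε ≤ 1 / 100) {C : Finset ℂ} (h : GoodAngles ε r₀ C) :
    RegularAngles r₀ C := by
  intro x hx y hy z hz hyz
  obtain ⟨j, hj1, hj3, hj⟩ := h.exists_index hx hy hz hyz
  obtain ⟨h1, h2⟩ := quarter_of_cwAngle hε (mem_neighbors.1 hy).1 (mem_neighbors.1 hz).1 hj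
  rw [h2]
  exact ⟨hj.trans hε, by omega⟩

theorem dist_le_half_of_floor_eq {y z m : ℂ} (h1 : ⌊3 * (y - m).re⌋ = ⌊3 * (z - m).re⌋)
    (h2 : ⌊3 * (y - m).im⌋ = ⌊3 * (z - m).im⌋) : dist y z ≤ 1 / 2 := by
  have a1 := abs_lt.1 (Int.abs_sub_lt_one_of_floor_eq_floor h1)
  have a2 := abs_lt.1 (Int.abs_sub_lt_one_of_floor_eq_floor h2)
  simp only [Complex.sub_re, Complex.sub_im] at a1 a2
  have b1 : (y.re - z.re) ^ 2 ≤ (1 / 3) ^ 2 := sq_le_sq' (by linarith) (by linarith)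
  have b2 : (y.im - z.im) ^ 2 ≤ (1 / 3) ^ 2 := sq_le_sq' (by linarith) (by linarith)
  refine abs_le_of_sq_le_sq' ?_ (by norm_num) |>.2
  rw [Complex.dist_eq, Complex.sq_norm, Complex.normSq_apply, Complex.sub_re, Complex.sub_im]
  linarith

/-- Disjoint discs around separated points of a disc. -/
theorem card_mul_sq_le_of_separated {N : Finset ℂ} {x : ℂ} {r ρ : ℝ} (hρ : 0 < ρ) (hr : 0 ≤ r)
    (hN : ∀ y ∈ N, dist x y ≤ r) (hsep : ∀ y ∈ N, ∀ z ∈ N, y ≠ z → 2 * ρ ≤ dist y z) :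
    (N.card : ℝ) * ρ ^ 2 ≤ (r + ρ) ^ 2 := by
  have hdisj : (N : Set ℂ).PairwiseDisjoint fun y => Metric.ball y ρ := by
    intro y hy z hz hyz
    exact Metric.ball_disjoint_ball (by linarith [hsep y hy z hz hyz])
  have h1 := MeasureTheory.measure_biUnion_finset (μ := MeasureTheory.volume) hdisj
    (fun y _ => measurableSet_ball)
  have h2 : (⋃ y ∈ N, Metric.ball y ρ) ⊆ Metric.ball x (r + ρ) := by
    refine Set.iUnion₂_subset fun y hy => Metric.ball_subset_ball' ?_
    rw [dist_comm]; linarith [hN y hy]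
  have h3 := MeasureTheory.measure_mono (μ := MeasureTheory.volume) h2
  rw [h1] at h3
  simp only [Complex.volume_ball, Finset.sum_const, nsmul_eq_mul] at h3
  rw [← mul_assoc, ENNReal.mul_le_mul_iff_left (by simpa using NNReal.pi_pos.ne') ENNReal.coe_ne_top,
    ← ENNReal.ofReal_pow hρ.le, ← ENNReal.ofReal_pow (by positivity), ← ENNReal.ofReal_natCast,
    ← ENNReal.ofReal_mul (by positivity), ENNReal.ofReal_le_ofReal_iff (by positivity)] at h3
  exact h3

section

variable {ε r₀ : ℝ} {v₂ : ℝ → EReal} {v₃ : ℝ → ℝ} (H : Admissible ε r₀ v₂ v₃)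
include H

theorem sum_toReal_eq (C : Finset ℂ) (x : ℂ) :
    ∑ y ∈ C.erase x, (v₂ (dist x y)).toReal = ∑ y ∈ neighbors r₀ C x, (v₂ (dist x y)).toReal := by
  rw [neighbors, Finset.sum_filter]
  refine Finset.sum_congr rfl fun y _ => ?_
  split_ifs with h
  · rfl
  · exact toReal_eq_zero H (not_le.1 h).le

variable {n : ℕ} {C : Finset ℂ} (hG : IsGroundState r₀ v₂ v₃ n C)
include hG

theorem IsGroundState.finitePairs : FinitePairs v₂ C := by
  obtain ⟨D, hD, hE⟩ := exists_competitor H (n := n) (R := 2 * (n + 1)) (by nlinarith)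
  apply finitePairs_of_energy_ne_top H (r₀ := r₀) (v₃ := v₃)
  exact ne_top_of_le_ne_top (EReal.coe_ne_top _) ((hG.2 D hD).trans hE)

theorem IsGroundState.realEnergy_le_competitor {R : ℕ} (hR : 4 * n ≤ R ^ 2) :
    realEnergy r₀ v₂ v₃ C ≤ R - 2 * n := by
  obtain ⟨D, hD, hE⟩ := exists_competitor H hR
  have := (hG.2 D hD).trans hE
  rwa [energy_eq_coe H (IsGroundState.finitePairs H hG), EReal.coe_le_coe_iff] at this

/-- Moving one particle beyond the interaction range of all others keeps the number of particles, so
it cannot lower the energy. -/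
theorem IsGroundState.realEnergy_le_erase {x : ℂ} (hx : x ∈ C) :
    realEnergy r₀ v₂ v₃ C ≤ realEnergy r₀ v₂ v₃ (C.erase x) := by
  have hfin := IsGroundState.finitePairs H hG
  set p : ℂ := ((∑ y ∈ C, ‖y‖ + 3 : ℝ) : ℂ) with hp
  have hr3 : r₀ < 3 := by
    refine H.r₀_lt.trans ?_
    rw [Real.sqrt_lt' (by norm_num)]
    norm_num
  have hfar : ∀ y ∈ C.erase x, r₀ < dist y p := by
    intro y hy
    have h1 : ‖y‖ ≤ ∑ y ∈ C, ‖y‖ :=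
      Finset.single_le_sum (f := fun y : ℂ => ‖y‖) (fun _ _ => norm_nonneg _)
        (Finset.mem_of_mem_erase hy)
    have h2 : ‖p‖ = ∑ y ∈ C, ‖y‖ + 3 := by
      rw [hp, Complex.norm_real, Real.norm_of_nonneg]
      have := Finset.sum_nonneg (s := C) fun y _ => norm_nonneg y
      linarith
    have h3 := norm_sub_norm_le p y
    rw [dist_comm, dist_eq_norm]
    linarith
  have hpn : p ∉ C.erase x := by
    intro h
    have := hfar p h
    rw [dist_self] at this
    linarith [H.one_lt_r₀]
  have hcard : (C.erase x ∪ {p}).card = n := by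
    rw [Finset.card_union_of_disjoint (Finset.disjoint_singleton_right.2 hpn),
      Finset.card_erase_of_mem hx, Finset.card_singleton, hG.1]
    have := Finset.card_pos.2 ⟨x, hx⟩
    rw [hG.1] at this
    omega
  have hfinD : FinitePairs v₂ (C.erase x ∪ {p}) := by
    intro y hy z hz hyz
    rw [Finset.mem_union, Finset.mem_singleton] at hy hz
    rcases hy with hy | rfl <;> rcases hz with hz | rfl
    · exact hfin y (Finset.mem_of_mem_erase hy) z (Finset.mem_of_mem_erase hz) hyz
    · rw [H.cutoff₂ _ (hfar y hy).le]; simp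
    · rw [dist_comm, H.cutoff₂ _ (hfar z hz).le]; simp
    · exact absurd rfl hyz
  have h1 := hG.2 _ hcard
  rw [energy_eq_coe H hfin, energy_eq_coe H hfinD, EReal.coe_le_coe_iff,
    realEnergy_union H (fun y hy z hz => by
      rw [Finset.mem_singleton.1 hz]; exact hfar y hy)] at h1
  have h2 : realEnergy r₀ v₂ v₃ {p} = 0 := by
    simp [realEnergy, angleEnergy, neighbors]
  linarith

/-- Otherwise moving x far away would gain energy. Removing x deletes its bond energies in full, as
both orders of each pair disappear, but possibly only half of the double-counted angle sum at x. -/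
theorem IsGroundState.site_nonpos {x : ℂ} (hx : x ∈ C) :
    ∑ y ∈ C.erase x, (v₂ (dist x y)).toReal + 1 / 2 * angleEnergy r₀ v₃ C x ≤ 0 := by
  have h1 := IsGroundState.realEnergy_le_erase H hG hx
  have h2 := realEnergy_insert_ge H (Finset.notMem_erase x C)
  rw [Finset.insert_erase hx] at h2
  linarith

/-- At the particle m with the largest number k of particles within 1 - ε, repulsion costs at least
k/ε ≥ 1000k. By maximality of k, the attraction of all neighbors is at most 121(k + 1), so the
energy at m would be positive. -/
theorem IsGroundState.lt_dist (hε : 0 < ε) (hε' : ε < 1 / 1000) {x y : ℂ} (hx : x ∈ C) (hy : y ∈ C)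
    (hxy : x ≠ y) : 1 - ε < dist x y := by
  classical
  have hfin := IsGroundState.finitePairs H hG
  by_contra! hcon
  set k : ℂ → ℕ := fun x => ((C.erase x).filter fun y => dist x y ≤ 1 - ε).card with hk
  obtain ⟨m, hm, hmax⟩ := Finset.exists_max_image C k ⟨x, hx⟩
  have hK1 : 1 ≤ k m := le_trans (Finset.card_pos.2
    ⟨y, Finset.mem_filter.2 ⟨Finset.mem_erase.2 ⟨hxy.symm, hy⟩, hcon⟩⟩) (hmax x hx)
  have hsite := IsGroundState.site_nonpos H hG hm
  have hang := angleEnergy_nonneg H (r₀ := r₀) C m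
  have hrs : r₀ < 3 / 2 := H.r₀_lt.trans (by rw [Real.sqrt_lt' (by norm_num)]; norm_num)
  have hN : (neighbors r₀ C m).card ≤ (k m + 1) * 121 := by
    -- Cells of side 1/3 have diameter below 1/2 < 1 - ε, so each holds at most k + 1 neighbors; as
    -- r₀ < 3/2, a block of 11 by 11 cells suffices.
    set g : ℂ → ℤ × ℤ := fun y => (⌊3 * (y - m).re⌋, ⌊3 * (y - m).im⌋) with hg
    have h1 : (neighbors r₀ C m).image g ⊆ Finset.Icc (-5 : ℤ) 5 ×ˢ Finset.Icc (-5 : ℤ) 5 := by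
      intro q hq
      obtain ⟨y, hy, rfl⟩ := Finset.mem_image.1 hq
      have hd : ‖y - m‖ ≤ r₀ := by
        rw [← dist_eq_norm, dist_comm]; exact (mem_neighbors.1 hy).2.2
      have h1 := abs_le.1 ((Complex.abs_re_le_norm (y - m)).trans hd)
      have h2 := abs_le.1 ((Complex.abs_im_le_norm (y - m)).trans hd)
      simp only [hg, Finset.mem_product, Finset.mem_Icc]
      refine ⟨⟨?_, ?_⟩, ⟨?_, ?_⟩⟩
      · rw [Int.le_floor]; push_cast; linarith
      · apply Int.lt_add_one_iff.1; rw [Int.floor_lt]; push_cast; linarith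
      · rw [Int.le_floor]; push_cast; linarith
      · apply Int.lt_add_one_iff.1; rw [Int.floor_lt]; push_cast; linarith
    have h2 := Finset.card_le_card h1
    have h3 : (Finset.Icc (-5 : ℤ) 5 ×ˢ Finset.Icc (-5 : ℤ) 5).card = 121 := by
      rw [Finset.card_product]; rfl
    rw [h3] at h2
    refine (Finset.card_le_mul_card_image (f := g) (neighbors r₀ C m) (k m + 1) ?_).trans
      (Nat.mul_le_mul_left _ h2)
    intro q hq
    obtain ⟨y, hy, rfl⟩ := Finset.mem_image.1 hq
    have hyC := (mem_neighbors.1 hy).2.1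
    have hsub : (neighbors r₀ C m).filter (fun z => g z = g y) ⊆
        insert y ((C.erase y).filter fun z => dist y z ≤ 1 - ε) := by
      intro z hz
      obtain ⟨hz, hgz⟩ := Finset.mem_filter.1 hz
      by_cases hzy : z = y
      · rw [hzy]; exact Finset.mem_insert_self _ _
      refine Finset.mem_insert_of_mem (Finset.mem_filter.2
        ⟨Finset.mem_erase.2 ⟨hzy, (mem_neighbors.1 hz).2.1⟩, ?_⟩)
      simp only [hg, Prod.mk.injEq] at hgz
      have := dist_le_half_of_floor_eq hgz.1.symm hgz.2.symm
      linarith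
    refine (Finset.card_le_card hsub).trans ((Finset.card_insert_le _ _).trans ?_)
    exact Nat.add_le_add_right (hmax y hyC) 1
  have hsum : (k m : ℝ) * ε⁻¹ - (neighbors r₀ C m).card ≤
      ∑ y ∈ C.erase m, (v₂ (dist m y)).toReal := by
    rw [hk, neighbors]
    simp only [Finset.card_filter]
    push_cast
    rw [Finset.sum_mul, ← Finset.sum_sub_distrib]
    refine Finset.sum_le_sum fun y hy => ?_
    obtain ⟨hym, hyC⟩ := Finset.mem_erase.1 hy
    have ht := hfin m hm y hyC hym.symm
    by_cases c1 : dist m y ≤ 1 - ε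
    · have c2 : dist m y ≤ r₀ := by linarith [H.one_lt_r₀]
      rw [if_pos c1, if_pos c2]
      have := H.repulsion₂ _ dist_nonneg c1
      rw [← EReal.coe_toReal ht (v₂_ne_bot H dist_nonneg), EReal.coe_lt_coe_iff] at this
      linarith
    · rw [if_neg c1]
      split_ifs with c2
      · linarith [neg_one_le_toReal H dist_nonneg ht]
      · rw [toReal_eq_zero H (not_le.1 c2).le]; norm_num
  have h5 : (1000 : ℝ) ≤ ε⁻¹ := by
    rw [le_inv_comm₀ (by norm_num) hε]
    norm_num; linarith
  have h6 : ((neighbors r₀ C m).card : ℝ) ≤ (k m + 1) * 121 := by exact_mod_cast hN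
  have h7 : (1 : ℝ) ≤ k m := by exact_mod_cast hK1
  have h8 : (k m : ℝ) * 1000 ≤ k m * ε⁻¹ := by gcongr
  linarith

/-- A bad angle is counted in both orders, so after the factor 1/2 it costs more than B, the bound
in `large₃`. Packing discs of radius (1 - ε)/2 shows that a particle has at most B neighbors, so
they cannot compensate. -/
theorem IsGroundState.goodAngles (hε : 0 < ε) (hε' : ε < 1 / 1000) : GoodAngles ε r₀ C := by
  classical
  have hfin := IsGroundState.finitePairs H hG
  intro x hx y hy z hz hyz
  by_contra hcon
  simp only [not_or] at hcon
  set B := 4 / (1 - ε) ^ 2 * (Real.sqrt 2 + 1 / 2) ^ 2 with hB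
  have hm := cwAngle_mem (y - x) (z - x)
  have h1 : B < v₃ (cwAngle (y - x) (z - x)) :=
    H.large₃ _ ⟨hm.1, hm.2.le⟩ hcon.1 hcon.2.1 hcon.2.2
  have h2 : B < v₃ (cwAngle (z - x) (y - x)) := by
    rcases cwAngle_swap (sub_ne_zero.2 (mem_neighbors.1 hy).1)
      (sub_ne_zero.2 (mem_neighbors.1 hz).1) with h | h
    · rw [h.2, ← h.1]; exact h1
    · rw [h, ← H.symm₃ _ ⟨hm.1, hm.2.le⟩]; exact h1
  have h3 : v₃ (cwAngle (y - x) (z - x)) + v₃ (cwAngle (z - x) (y - x)) ≤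
      angleEnergy r₀ v₃ C x := by
    set f : ℂ → ℝ := fun y => ∑ z ∈ (neighbors r₀ C x).erase y, v₃ (cwAngle (y - x) (z - x)) with hf
    have hf0 : ∀ y, 0 ≤ f y := fun y => Finset.sum_nonneg fun _ _ => v₃_nonneg H _ _
    have e1 : v₃ (cwAngle (y - x) (z - x)) ≤ f y :=
      Finset.single_le_sum (f := fun z => v₃ (cwAngle (y - x) (z - x)))
        (fun _ _ => v₃_nonneg H _ _) (Finset.mem_erase.2 ⟨hyz.symm, hz⟩)
    have e2 : v₃ (cwAngle (z - x) (y - x)) ≤ f z :=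
      Finset.single_le_sum (f := fun y => v₃ (cwAngle (z - x) (y - x)))
        (fun _ _ => v₃_nonneg H _ _) (Finset.mem_erase.2 ⟨hyz, hy⟩)
    have e3 : ∑ w ∈ {y, z}, f w ≤ ∑ w ∈ neighbors r₀ C x, f w :=
      Finset.sum_le_sum_of_subset_of_nonneg (by
        intro w hw
        rcases Finset.mem_insert.1 hw with rfl | hw
        · exact hy
        · rw [Finset.mem_singleton.1 hw]; exact hz) fun w _ _ => hf0 w
    rw [Finset.sum_pair hyz] at e3
    exact (add_le_add e1 e2).trans e3
  have h4 : -((neighbors r₀ C x).card : ℝ) ≤ ∑ y ∈ C.erase x, (v₂ (dist x y)).toReal := by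
    rw [sum_toReal_eq H, ← nsmul_one, ← Finset.sum_const, ← Finset.sum_neg_distrib]
    refine Finset.sum_le_sum fun y hy => ?_
    obtain ⟨c1, c2, -⟩ := mem_neighbors.1 hy
    exact neg_one_le_toReal H dist_nonneg (hfin x hx y c2 c1.symm)
  have h5 : ((neighbors r₀ C x).card : ℝ) ≤ B := by
    have hρ : 0 < (1 - ε) / 2 := by linarith
    have := card_mul_sq_le_of_separated hρ (by linarith [H.one_lt_r₀])
      (fun y hy => (mem_neighbors.1 hy).2.2) (x := x) (N := neighbors r₀ C x) (fun y hy z hz hyz => by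
        have := IsGroundState.lt_dist H hG hε hε' (mem_neighbors.1 hy).2.1
          (mem_neighbors.1 hz).2.1 hyz
        linarith)
    have h6 : (r₀ + (1 - ε) / 2) ^ 2 ≤ (Real.sqrt 2 + 1 / 2) ^ 2 := by
      have := H.one_lt_r₀
      have := H.r₀_lt
      gcongr
      linarith
    have h7 : B = (Real.sqrt 2 + 1 / 2) ^ 2 / ((1 - ε) / 2) ^ 2 := by
      have : (1 - ε) ≠ 0 := by linarith
      rw [hB]; field_simp; norm_num
    rw [h7, le_div_iff₀ (by positivity)]
    exact this.trans h6
  have h6 := IsGroundState.site_nonpos H hG hx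
  linarith

end

/-! ### The sharp lower bound for the energy -/

/-- A configuration with good angles consists of a number of chains that satisfies the
isoperimetric inequality and bounds the energy from below. -/
theorem exists_chain_number_le_energy {ε r₀ : ℝ} {v₂ : ℝ → EReal} {v₃ : ℝ → ℝ}
    (H : Admissible ε r₀ v₂ v₃) (hε : 0 < ε) (hε' : ε < 1 / 1000) {C : Finset ℂ}
    (hC : GoodAngles ε r₀ C) :
    ∃ R : ℕ, 4 * C.card ≤ R ^ 2 ∧
      R + 1 / 2 * ∑ x ∈ C, ∑ y ∈ neighbors r₀ C x, (1 + (v₂ (dist x y)).toReal) +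
        1 / 6 * ∑ x ∈ C, angleEnergy r₀ v₃ C x ≤ 2 * C.card + realEnergy r₀ v₂ v₃ C := by
  have hreg := hC.regular (by linarith)
  obtain ⟨R, hR, h⟩ := exists_chain_number hreg
  refine ⟨R, hR, ?_⟩
  have hp := Real.pi_gt_three
  -- Here 24/π = 4/(π/6) is below the slope of v₃ at π and is three times the cost 8/π of the cuts.
  -- So a third of the angle sum pays for the cuts, and 1/2 - 1/3 = 1/6 of it remains as surplus.
  have h1 : ∑ t ∈ straightAngles r₀ C, 24 / Real.pi * |deviation t.1 t.2.1 t.2.2| ≤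
      ∑ x ∈ C, angleEnergy r₀ v₃ C x := by
    have : ∑ x ∈ C, angleEnergy r₀ v₃ C x = ∑ t ∈ C.sigma fun x => (neighbors r₀ C x).sigma fun y =>
        (neighbors r₀ C x).erase y, v₃ (cwAngle (t.2.1 - t.1) (t.2.2 - t.1)) := by
      rw [Finset.sum_sigma]
      refine Finset.sum_congr rfl fun x _ => ?_
      rw [Finset.sum_sigma]
      rfl
    rw [this]
    refine (Finset.sum_le_sum fun t ht => ?_).trans
      (Finset.sum_le_sum_of_subset_of_nonneg (Finset.filter_subset _ _) fun t _ _ =>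
        v₃_nonneg H _ _)
    obtain ⟨x, y, z⟩ := t
    obtain ⟨hx, hy, hz, hne, hq⟩ := mem_straightAngles.1 ht
    simp only
    obtain ⟨j, hj1, hj3, hj⟩ := hC.exists_index hx hy hz hne.symm
    obtain ⟨a1, a2⟩ := quarter_of_cwAngle (by linarith) (mem_neighbors.1 hy).1
      (mem_neighbors.1 hz).1 hj
    have hj2 : j = 2 := by omega
    subst hj2
    have e : ((2 : ℤ) : ℝ) * (Real.pi / 2) = Real.pi := by push_cast; ring
    rw [e] at hj a2
    have hj' := abs_le.1 hj
    rw [a2]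
    refine le_trans ?_ (H.slope₃ _ ⟨by linarith [hj'.1], by linarith [hj'.2]⟩).1
    gcongr
    rw [← div_eq_mul_inv, div_le_div_iff₀ (by linarith) (by linarith)]
    linarith
  have h2 : ∑ t ∈ straightAngles r₀ C, 24 / Real.pi * |deviation t.1 t.2.1 t.2.2| =
      3 * ∑ t ∈ straightAngles r₀ C, 8 / Real.pi * |deviation t.1 t.2.1 t.2.2| := by
    rw [Finset.mul_sum]
    exact Finset.sum_congr rfl fun t _ => by ring
  have h3 : realEnergy r₀ v₂ v₃ C = 1 / 2 * ∑ x ∈ C, ∑ y ∈ neighbors r₀ C x, (v₂ (dist x y)).toReal +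
      1 / 2 * ∑ x ∈ C, angleEnergy r₀ v₃ C x := by
    rw [realEnergy, Finset.sum_add_distrib, ← Finset.mul_sum, ← Finset.mul_sum]
    simp_rw [sum_toReal_eq H]
  have h4 : ∑ x ∈ C, ∑ y ∈ neighbors r₀ C x, (1 + (v₂ (dist x y)).toReal) =
      ∑ x ∈ C, ((neighbors r₀ C x).card : ℝ) +
        ∑ x ∈ C, ∑ y ∈ neighbors r₀ C x, (v₂ (dist x y)).toReal := by
    rw [← Finset.sum_add_distrib]
    refine Finset.sum_congr rfl fun x _ => ?_
    rw [Finset.sum_add_distrib, Finset.sum_const, nsmul_one]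
  rw [h3, h4]
  rw [h2] at h1
  linarith

/-! ### Rigidity: ground states lie in a square lattice -/

theorem pow_four_eq_of_cwAngle {u w : ℂ} (hu : ‖u‖ = 1) (hw : ‖w‖ = 1) {j : ℤ}
    (h : cwAngle u w = j * (Real.pi / 2)) : u ^ 4 = w ^ 4 := by
  have hw0 : w ≠ 0 := norm_pos_iff.1 (by rw [hw]; exact one_pos)
  have hq : ‖u / w‖ = 1 := by rw [norm_div, hu, hw, div_one]
  have h1 : ((4 * Complex.arg (u / w) : ℝ) : ℂ) * Complex.I =
      ((j + 4 * toIcoDiv Real.two_pi_pos 0 (Complex.arg (u / w)) : ℤ) : ℂ) *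
        (2 * Real.pi * Complex.I) := by
    have : 4 * Complex.arg (u / w) =
        ((j + 4 * toIcoDiv Real.two_pi_pos 0 (Complex.arg (u / w)) : ℤ) : ℝ) * (2 * Real.pi) := by
      rw [cwAngle, toIcoMod, zsmul_eq_mul] at h
      push_cast
      linarith
    rw [this]
    push_cast
    ring
  have h2 : (u / w) ^ 4 = 1 := by
    rw [← Complex.norm_mul_exp_arg_mul_I (u / w), hq, Complex.ofReal_one, one_mul,
      ← Complex.exp_nat_mul]
    have : ((4 : ℕ) : ℂ) * (Complex.arg (u / w) * Complex.I) =
        ((4 * Complex.arg (u / w) : ℝ) : ℂ) * Complex.I := by push_cast; ring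
    rw [this, h1, Complex.exp_int_mul_two_pi_mul_I]
  rw [div_pow, div_eq_one_iff_eq (pow_ne_zero _ hw0)] at h2
  exact h2

theorem exists_unitStep {u v : ℂ} (hu : u ≠ 0) (h : v ^ 4 = u ^ 4) :
    ∃ e ∈ unitSteps, v = u * latticePoint e := by
  have h1 : (v / u) ^ 4 = 1 := by rw [div_pow, h, div_self (pow_ne_zero _ hu)]
  have h2 : v = u * (v / u) := by field_simp
  rcases eq_of_pow_four_eq_one h1 with h | h | h | h
  · refine ⟨(1, 0), by decide, ?_⟩
    rw [h2, h]; congr 1; apply Complex.ext <;> simp [latticePoint]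
  · refine ⟨(-1, 0), by decide, ?_⟩
    rw [h2, h]; congr 1; apply Complex.ext <;> simp [latticePoint]
  · refine ⟨(0, 1), by decide, ?_⟩
    rw [h2, h]; congr 1; apply Complex.ext <;> simp [latticePoint]
  · refine ⟨(0, -1), by decide, ?_⟩
    rw [h2, h]; congr 1; apply Complex.ext <;> simp [latticePoint]

theorem latticePoint_add (p q : ℤ × ℤ) :
    latticePoint (p + q) = latticePoint p + latticePoint q := by
  apply Complex.ext <;> simp [latticePoint]

section

variable {ε r₀ : ℝ} {v₂ : ℝ → EReal} {v₃ : ℝ → ℝ} (H : Admissible ε r₀ v₂ v₃)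
include H

theorem sum_bonds_nonneg {C : Finset ℂ} (hC : FinitePairs v₂ C) :
    ∀ x ∈ C, ∀ y ∈ neighbors r₀ C x, 0 ≤ 1 + (v₂ (dist x y)).toReal := by
  intro x hx y hy
  obtain ⟨h1, h2, -⟩ := mem_neighbors.1 hy
  linarith [neg_one_le_toReal H dist_nonneg (hC x hx y h2 h1.symm)]

theorem exists_chain_number_le_energy' (hε : 0 < ε) (hε' : ε < 1 / 1000) {C : Finset ℂ}
    (hC : GoodAngles ε r₀ C) (hfin : FinitePairs v₂ C) :
    ∃ R : ℕ, 4 * C.card ≤ R ^ 2 ∧ (R : ℝ) ≤ 2 * C.card + realEnergy r₀ v₂ v₃ C := by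
  obtain ⟨R, hR, h⟩ := exists_chain_number_le_energy H hε hε' hC
  refine ⟨R, hR, ?_⟩
  have h1 : 0 ≤ ∑ x ∈ C, ∑ y ∈ neighbors r₀ C x, (1 + (v₂ (dist x y)).toReal) :=
    Finset.sum_nonneg fun x hx => Finset.sum_nonneg fun y hy => sum_bonds_nonneg H hfin x hx y hy
  have h2 : 0 ≤ ∑ x ∈ C, angleEnergy r₀ v₃ C x :=
    Finset.sum_nonneg fun x _ => angleEnergy_nonneg H C x
  linarith

variable {n : ℕ} {C : Finset ℂ} (hG : IsGroundState r₀ v₂ v₃ n C) (hε : 0 < ε) (hε' : ε < 1 / 1000)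
include hG hε' hε

/-- The ground states have no elastic energy. -/
theorem IsGroundState.no_defects :
    (∀ x ∈ C, ∀ y ∈ neighbors r₀ C x, (v₂ (dist x y)).toReal = -1) ∧
      ∀ x ∈ C, angleEnergy r₀ v₃ C x = 0 := by
  have hfin := IsGroundState.finitePairs H hG
  obtain ⟨R, hR, h⟩ := exists_chain_number_le_energy H hε hε' (IsGroundState.goodAngles H hG hε hε')
  rw [hG.1] at hR h
  -- The competitor is built from the chain number R itself, so lower and upper bound coincide and
  -- both nonnegative surplus terms vanish.
  have h3 := IsGroundState.realEnergy_le_competitor H hG hR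
  have hb := sum_bonds_nonneg H hfin
  have h1 : 0 ≤ ∑ x ∈ C, ∑ y ∈ neighbors r₀ C x, (1 + (v₂ (dist x y)).toReal) :=
    Finset.sum_nonneg fun x hx => Finset.sum_nonneg fun y hy => hb x hx y hy
  have h2 : 0 ≤ ∑ x ∈ C, angleEnergy r₀ v₃ C x :=
    Finset.sum_nonneg fun x _ => angleEnergy_nonneg H C x
  constructor
  · have h4 : ∑ x ∈ C, ∑ y ∈ neighbors r₀ C x, (1 + (v₂ (dist x y)).toReal) = 0 := by linarith
    intro x hx y hy
    have h5 := (Finset.sum_eq_zero_iff_of_nonneg fun x hx =>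
      Finset.sum_nonneg fun y hy => hb x hx y hy).1 h4 x hx
    have h6 := (Finset.sum_eq_zero_iff_of_nonneg fun y hy => hb x hx y hy).1 h5 y hy
    linarith
  · have h4 : ∑ x ∈ C, angleEnergy r₀ v₃ C x = 0 := by linarith
    exact (Finset.sum_eq_zero_iff_of_nonneg fun x _ => angleEnergy_nonneg H C x).1 h4

theorem IsGroundState.dist_eq_one {x y : ℂ} (hx : x ∈ C) (hy : y ∈ neighbors r₀ C x) :
    dist x y = 1 := by
  obtain ⟨h1, h2, -⟩ := mem_neighbors.1 hy
  exact eq_one_of_toReal_eq H dist_nonneg (IsGroundState.finitePairs H hG x hx y h2 h1.symm)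
    ((IsGroundState.no_defects H hG hε hε').1 x hx y hy)

theorem IsGroundState.pow_four_eq {x y z : ℂ} (hx : x ∈ C) (hy : y ∈ neighbors r₀ C x)
    (hz : z ∈ neighbors r₀ C x) : (y - x) ^ 4 = (z - x) ^ 4 := by
  by_cases hyz : y = z
  · rw [hyz]
  have h1 := (IsGroundState.no_defects H hG hε hε').2 x hx
  have h2 := (Finset.sum_eq_zero_iff_of_nonneg fun y _ =>
    Finset.sum_nonneg fun _ _ => v₃_nonneg H _ _).1 h1 y hy
  have h3 := (Finset.sum_eq_zero_iff_of_nonneg fun _ _ => v₃_nonneg H _ _).1 h2 z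
    (Finset.mem_erase.2 ⟨fun h => hyz h.symm, hz⟩)
  have hm := cwAngle_mem (y - x) (z - x)
  have hu : ‖y - x‖ = 1 := by
    rw [← dist_eq_norm, dist_comm]; exact IsGroundState.dist_eq_one H hG hε hε' hx hy
  have hw : ‖z - x‖ = 1 := by
    rw [← dist_eq_norm, dist_comm]; exact IsGroundState.dist_eq_one H hG hε hε' hx hz
  by_cases c1 : cwAngle (y - x) (z - x) = Real.pi / 2
  · exact pow_four_eq_of_cwAngle hu hw (j := 1) (by rw [c1]; push_cast; ring)
  by_cases c2 : cwAngle (y - x) (z - x) = Real.pi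
  · exact pow_four_eq_of_cwAngle hu hw (j := 2) (by rw [c2]; push_cast; ring)
  by_cases c3 : cwAngle (y - x) (z - x) = 3 * Real.pi / 2
  · exact pow_four_eq_of_cwAngle hu hw (j := 3) (by rw [c3]; push_cast; ring)
  exact absurd h3.symm (H.pos₃ _ ⟨hm.1, hm.2.le⟩ c1 c2 c3).ne

/-- The bond graph of a ground state is connected. -/
theorem IsGroundState.eq_of_closed {A : Finset ℂ} (hA : A ⊆ C) (hne : A.Nonempty)
    (hcl : ∀ x ∈ A, neighbors r₀ C x ⊆ A) : A = C := by
  by_contra hAC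
  have hB : (C \ A).Nonempty := by
    rw [Finset.sdiff_nonempty]
    exact fun h => hAC (hA.antisymm h)
  have hgood := IsGroundState.goodAngles H hG hε hε'
  have hfin := IsGroundState.finitePairs H hG
  have hBC : C \ A ⊆ C := Finset.sdiff_subset
  obtain ⟨R, hR, h1⟩ := exists_chain_number_le_energy' H hε hε' (hgood.subset hA)
    (fun x hx y hy => hfin x (hA hx) y (hA hy))
  obtain ⟨S, hS, h2⟩ := exists_chain_number_le_energy' H hε hε' (hgood.subset hBC)
    (fun x hx y hy => hfin x (hBC hx) y (hBC hy))
  have h3 := realEnergy_union H (A := A) (B := C \ A) (fun x hx y hy => by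
    by_contra! hd
    obtain ⟨hyC, hyA⟩ := Finset.mem_sdiff.1 hy
    exact hyA (hcl x hx (mem_neighbors.2 ⟨fun h => hyA (h ▸ hx), hyC, hd⟩)))
  rw [Finset.union_sdiff_of_subset hA] at h3
  have hcard : A.card + (C \ A).card = n := by
    rw [Finset.card_sdiff_of_subset hA, hG.1]
    have := Finset.card_le_card hA
    rw [hG.1] at this
    omega
  have hA1 := Finset.card_pos.2 hne
  have hB1 := Finset.card_pos.2 hB
  -- With R, S ≥ 2 one has R² + S² ≤ (R + S - 1)², so R + S - 1 is admissible for a competitor. Its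
  -- energy is below R + S - 2n, the lower bound for two unconnected pieces.
  have hR2 : 2 ≤ R := by nlinarith
  have hS2 : 2 ≤ S := by nlinarith
  obtain ⟨r, rfl⟩ := Nat.exists_eq_add_of_le hR2
  obtain ⟨s, rfl⟩ := Nat.exists_eq_add_of_le hS2
  have h4 := IsGroundState.realEnergy_le_competitor H hG (R := 3 + r + s) (by nlinarith)
  have h5 : (A.card : ℝ) + (C \ A).card = n := by exact_mod_cast hcard
  push_cast at h1 h2 h4
  linarith

/-- A ground state is a subset of a rotated and translated square lattice, and bonds connect
lattice neighbors. -/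
theorem IsGroundState.exists_lattice (hn : 0 < n) :
    ∃ (x₀ u : ℂ) (P : Finset (ℤ × ℤ)), ‖u‖ = 1 ∧ P.card = n ∧
      C = P.image (fun k => x₀ + u * latticePoint k) ∧
      ∀ p ∈ P, ∀ q ∈ P, x₀ + u * latticePoint q ∈ neighbors r₀ C (x₀ + u * latticePoint p) →
        ∃ e ∈ unitSteps, q = p + e := by
  classical
  obtain ⟨x₀, hx₀⟩ := Finset.card_pos.1 (hG.1.symm ▸ hn)
  obtain ⟨u, hu, hu4⟩ : ∃ u : ℂ, ‖u‖ = 1 ∧ ∀ y ∈ neighbors r₀ C x₀, (y - x₀) ^ 4 = u ^ 4 := by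
    by_cases h : ∃ y₀, y₀ ∈ neighbors r₀ C x₀
    · obtain ⟨y₀, hy₀⟩ := h
      refine ⟨y₀ - x₀, ?_, fun y hy => IsGroundState.pow_four_eq H hG hε hε' hx₀ hy hy₀⟩
      rw [← dist_eq_norm, dist_comm]
      exact IsGroundState.dist_eq_one H hG hε hε' hx₀ hy₀
    · exact ⟨1, by simp, fun y hy => absurd ⟨y, hy⟩ h⟩
  have hu0 : u ≠ 0 := norm_pos_iff.1 (by rw [hu]; exact one_pos)
  have hinj : Function.Injective fun k => x₀ + u * latticePoint k := by
    intro p q h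
    exact latticePoint_injective (mul_left_cancel₀ hu0 (add_left_cancel h))
  -- The fourth power encodes a direction up to right angles and is unchanged when a bond is
  -- reversed. Hence the condition passes along bonds, and connectedness extends it to all
  -- particles.
  have hall : C.filter (fun z => (∃ k, z = x₀ + u * latticePoint k) ∧
      ∀ y ∈ neighbors r₀ C z, (y - z) ^ 4 = u ^ 4) = C := by
    refine IsGroundState.eq_of_closed H hG hε hε' (Finset.filter_subset _ _) ⟨x₀, ?_⟩ ?_
    · refine Finset.mem_filter.2 ⟨hx₀, ⟨0, ?_⟩, hu4⟩
      have : latticePoint 0 = 0 := by apply Complex.ext <;> simp [latticePoint]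
      rw [this, mul_zero, add_zero]
    · intro z hz y hy
      obtain ⟨hzC, ⟨k, hk⟩, hz4⟩ := Finset.mem_filter.1 hz
      have hyC := (mem_neighbors.1 hy).2.1
      refine Finset.mem_filter.2 ⟨hyC, ?_, ?_⟩
      · obtain ⟨e, -, he⟩ := exists_unitStep hu0 (hz4 y hy)
        refine ⟨k + e, ?_⟩
        rw [latticePoint_add, mul_add, ← he, ← add_assoc, ← hk]
        ring
      · intro w hw
        rw [IsGroundState.pow_four_eq H hG hε hε' hyC hw (neighbors_symm hzC hy), ← hz4 y hy]
        ring
  have hC : ∀ z ∈ C, (∃ k, z = x₀ + u * latticePoint k) ∧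
      ∀ y ∈ neighbors r₀ C z, (y - z) ^ 4 = u ^ 4 := by
    intro z hz
    rw [← hall] at hz
    exact (Finset.mem_filter.1 hz).2
  set P := C.preimage (fun k => x₀ + u * latticePoint k) hinj.injOn with hP
  have hCP : C = P.image (fun k => x₀ + u * latticePoint k) := by
    rw [hP, Finset.image_preimage, Finset.filter_true_of_mem]
    intro z hz
    obtain ⟨k, hk⟩ := (hC z hz).1
    exact ⟨k, hk.symm⟩
  refine ⟨x₀, u, P, hu, ?_, hCP, ?_⟩
  · rw [← hG.1]
    conv_rhs => rw [hCP]
    exact (Finset.card_image_of_injective _ hinj).symm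
  · intro p hp q _ hq
    have h1 := (hC _ (Finset.mem_preimage.1 hp)).2 _ hq
    obtain ⟨e, he, h2⟩ := exists_unitStep hu0 h1
    refine ⟨e, he, hinj ?_⟩
    simp only
    rw [latticePoint_add, mul_add, ← h2]
    ring

end

/-! ### The surrounding rectangle -/

/-- The leftmost point of each nonempty row has no left neighbor. -/
theorem card_image_snd_add_le (P : Finset (ℤ × ℤ)) :
    (P.image Prod.snd).card + (P.filter fun p => p + (-1, 0) ∈ P).card ≤ P.card := by
  classical
  have h1 : (P.filter fun p => p + (-1, 0) ∈ P).card + (P.filter fun p => ¬ p + (-1, 0) ∈ P).card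
    = P.card := Finset.card_filter_add_card_filter_not _
  have h2 : P.image Prod.snd ⊆ (P.filter fun p => ¬ p + (-1, 0) ∈ P).image Prod.snd := by
    intro j hj
    obtain ⟨q, hq, rfl⟩ := Finset.mem_image.1 hj
    obtain ⟨p, hp, hmin⟩ := Finset.exists_min_image (P.filter fun p => p.2 = q.2) Prod.fst
      ⟨q, Finset.mem_filter.2 ⟨hq, rfl⟩⟩
    obtain ⟨hp, hpq⟩ := Finset.mem_filter.1 hp
    refine Finset.mem_image.2 ⟨p, Finset.mem_filter.2 ⟨hp, fun h => ?_⟩, hpq⟩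
    have := hmin _ (Finset.mem_filter.2 ⟨h, by simpa using hpq⟩)
    simp at this
  have h3 := (Finset.card_le_card h2).trans Finset.card_image_le
  omega

theorem card_image_fst_add_le (P : Finset (ℤ × ℤ)) :
    (P.image Prod.fst).card + (P.filter fun p => p + (0, -1) ∈ P).card ≤ P.card := by
  classical
  have h1 : (P.filter fun p => p + (0, -1) ∈ P).card + (P.filter fun p => ¬ p + (0, -1) ∈ P).card
    = P.card := Finset.card_filter_add_card_filter_not _
  have h2 : P.image Prod.fst ⊆ (P.filter fun p => ¬ p + (0, -1) ∈ P).image Prod.fst := by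
    intro j hj
    obtain ⟨q, hq, rfl⟩ := Finset.mem_image.1 hj
    obtain ⟨p, hp, hmin⟩ := Finset.exists_min_image (P.filter fun p => p.1 = q.1) Prod.snd
      ⟨q, Finset.mem_filter.2 ⟨hq, rfl⟩⟩
    obtain ⟨hp, hpq⟩ := Finset.mem_filter.1 hp
    refine Finset.mem_image.2 ⟨p, Finset.mem_filter.2 ⟨hp, fun h => ?_⟩, hpq⟩
    have := hmin _ (Finset.mem_filter.2 ⟨h, by simpa using hpq⟩)
    simp at this
  have h3 := (Finset.card_le_card h2).trans Finset.card_image_le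
  omega

/-- A finite set of integers without gaps is contained in an interval of its cardinality. -/
theorem exists_subset_Icc_of_no_gaps {J : Finset ℤ} (hne : J.Nonempty)
    (h : ∀ b, (∃ a ∈ J, a < b) → (∃ c ∈ J, b ≤ c) → b ∈ J) :
    ∃ l : ℤ, J ⊆ Finset.Icc (l + 1) (l + J.card) := by
  refine ⟨J.min' hne - 1, fun j hj => ?_⟩
  have h1 : Finset.Icc (J.min' hne) (J.max' hne) ⊆ J := by
    intro b hb
    obtain ⟨h1, h2⟩ := Finset.mem_Icc.1 hb
    rcases h1.eq_or_lt with h1 | h1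
    · rw [← h1]; exact J.min'_mem hne
    · exact h b ⟨_, J.min'_mem hne, h1⟩ ⟨_, J.max'_mem hne, h2⟩
  have h2 := Finset.card_le_card h1
  rw [Int.card_Icc] at h2
  have h3 := J.min'_le j hj
  have h4 := J.le_max' j hj
  rw [Finset.mem_Icc]
  omega

section

variable {ε r₀ : ℝ} {v₂ : ℝ → EReal} {v₃ : ℝ → ℝ} (H : Admissible ε r₀ v₂ v₃)
  {n : ℕ} {C : Finset ℂ} (hG : IsGroundState r₀ v₂ v₃ n C) (hε : 0 < ε) (hε' : ε < 1 / 1000)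
include H hG hε' hε

/-- A ground state is, up to a rigid motion, a subset of a lattice rectangle whose half perimeter is
as small as its number of points permits. -/
theorem IsGroundState.exists_rectangle (hn : 0 < n) {R : ℕ} (hR : 4 * n ≤ R ^ 2) :
    ∃ (φ : ℂ → ℂ) (P : Finset (ℤ × ℤ)) (a b : ℕ), IsRigidMotion φ ∧ P.card = n ∧
      C.image φ = P.image latticePoint ∧
      P ⊆ Finset.Icc (1 : ℤ) a ×ˢ Finset.Icc (1 : ℤ) b ∧ a + b ≤ R := by
  classical
  obtain ⟨x₀, u, P, hu, hPn, hCP, hbond⟩ := IsGroundState.exists_lattice H hG hε hε' hn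
  have hu0 : u ≠ 0 := norm_pos_iff.1 (by rw [hu]; exact one_pos)
  set f : ℤ × ℤ → ℂ := fun k => x₀ + u * latticePoint k with hf
  have hinj : Function.Injective f := by
    intro p q h
    exact latticePoint_injective (mul_left_cancel₀ hu0 (add_left_cancel h))
  have hPne : P.Nonempty := Finset.card_pos.1 (hPn.symm ▸ hn)
  -- A unit step changes a coordinate by at most 1. If a line between two occupied ones were empty,
  -- the points before it would be closed under bonds, contradicting connectedness.
  have hgap : ∀ g : ℤ × ℤ → ℤ, (∀ p, ∀ e ∈ unitSteps, g (p + e) ≤ g p + 1 ∧ g p - 1 ≤ g (p + e)) →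
      ∀ b, (∃ a ∈ P.image g, a < b) → (∃ c ∈ P.image g, b ≤ c) → b ∈ P.image g := by
    rintro g hg b ⟨a, ha, hab⟩ ⟨c, hc, hbc⟩
    by_contra hb
    obtain ⟨pa, hpa, rfl⟩ := Finset.mem_image.1 ha
    obtain ⟨pc, hpc, rfl⟩ := Finset.mem_image.1 hc
    have hmem : ∀ p ∈ P, f p ∈ C := fun p hp => by rw [hCP]; exact Finset.mem_image_of_mem f hp
    have := IsGroundState.eq_of_closed H hG hε hε' (A := (P.filter fun p => g p < b).image f)
      (by
        intro z hz
        obtain ⟨p, hp, rfl⟩ := Finset.mem_image.1 hz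
        exact hmem p (Finset.mem_filter.1 hp).1)
      ⟨f pa, Finset.mem_image_of_mem f (Finset.mem_filter.2 ⟨hpa, hab⟩)⟩
      (by
        intro z hz y hy
        obtain ⟨p, hp, rfl⟩ := Finset.mem_image.1 hz
        obtain ⟨hp, hpb⟩ := Finset.mem_filter.1 hp
        have hyC := (mem_neighbors.1 hy).2.1
        rw [hCP] at hyC
        obtain ⟨q, hq, rfl⟩ := Finset.mem_image.1 hyC
        obtain ⟨e, he, rfl⟩ := hbond p hp q hq hy
        refine Finset.mem_image_of_mem f (Finset.mem_filter.2 ⟨hq, ?_⟩)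
        have h1 := (hg p e he).1
        have h2 : g (p + e) ≠ b := fun h => hb (h ▸ Finset.mem_image_of_mem g hq)
        omega)
    have h3 := hmem pc hpc
    rw [← this] at h3
    obtain ⟨q, hq, hqp⟩ := Finset.mem_image.1 h3
    rw [hinj hqp] at hq
    have := (Finset.mem_filter.1 hq).2
    omega
  obtain ⟨l₁, hl₁⟩ := exists_subset_Icc_of_no_gaps (hPne.image Prod.fst) (hgap Prod.fst (by
    intro p e he
    have := mem_unitSteps.1 he
    rw [Prod.fst_add]
    constructor <;> nlinarith [sq_nonneg e.2]))
  obtain ⟨l₂, hl₂⟩ := exists_subset_Icc_of_no_gaps (hPne.image Prod.snd) (hgap Prod.snd (by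
    intro p e he
    have := mem_unitSteps.1 he
    rw [Prod.snd_add]
    constructor <;> nlinarith [sq_nonneg e.1]))
  refine ⟨fun z => u⁻¹ * z + (-(u⁻¹ * x₀) - latticePoint (l₁, l₂)), P.image fun p => p - (l₁, l₂),
    (P.image Prod.fst).card, (P.image Prod.snd).card, ⟨u⁻¹, _, by rw [norm_inv, hu, inv_one],
      fun z => rfl⟩, ?_, ?_, ?_, ?_⟩
  · rw [Finset.card_image_of_injective _ (sub_left_injective), hPn]
  · rw [hCP, Finset.image_image, Finset.image_image]
    refine Finset.image_congr fun p _ => ?_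
    simp only [Function.comp_apply, hf]
    rw [← latticePoint_sub]
    field_simp
    ring
  · intro q hq
    obtain ⟨p, hp, rfl⟩ := Finset.mem_image.1 hq
    have h1 := Finset.mem_Icc.1 (hl₁ (Finset.mem_image_of_mem _ hp))
    have h2 := Finset.mem_Icc.1 (hl₂ (Finset.mem_image_of_mem _ hp))
    simp only [Finset.mem_product, Finset.mem_Icc, Prod.fst_sub, Prod.snd_sub]
    omega
  · have hE := IsGroundState.realEnergy_le_competitor H hG hR
    have hdef := IsGroundState.no_defects H hG hε hε'
    have h1 : realEnergy r₀ v₂ v₃ C = -(1 / 2) * ∑ x ∈ C, ((neighbors r₀ C x).card : ℝ) := by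
      rw [realEnergy, Finset.mul_sum]
      refine Finset.sum_congr rfl fun x hx => ?_
      rw [hdef.2 x hx, sum_toReal_eq H, Finset.sum_congr rfl (hdef.1 x hx), Finset.sum_const]
      simp
    have h2 : ∑ x ∈ C, (neighbors r₀ C x).card ≤
        ∑ p ∈ P, (unitSteps.filter fun e => p + e ∈ P).card := by
      have : ∑ x ∈ C, (neighbors r₀ C x).card = ∑ p ∈ P, (neighbors r₀ C (f p)).card := by
        conv_lhs => rw [hCP]
        rw [Finset.sum_image hinj.injOn, ← hCP]
      rw [this]
      refine Finset.sum_le_sum fun p hp => ?_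
      have hsub : neighbors r₀ C (f p) ⊆
          (unitSteps.filter fun e => p + e ∈ P).image fun e => f (p + e) := by
        intro y hy
        have hyC := (mem_neighbors.1 hy).2.1
        rw [hCP] at hyC
        obtain ⟨q, hq, rfl⟩ := Finset.mem_image.1 hyC
        obtain ⟨e, he, rfl⟩ := hbond p hp q hq hy
        exact Finset.mem_image.2 ⟨e, Finset.mem_filter.2 ⟨he, hq⟩, rfl⟩
      exact (Finset.card_le_card hsub).trans Finset.card_image_le
    rw [sum_card_unitSteps] at h2
    have h3 := card_image_snd_add_le P
    have h4 := card_image_fst_add_le P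
    -- Each nonempty row and column costs at least one bond out of 2n, so an energy of at most R -
    -- 2n limits their total number to R.
    have h5 : ∑ x ∈ C, (neighbors r₀ C x).card + 2 * ((P.image Prod.fst).card +
      (P.image Prod.snd).card) ≤ 4 * n := by omega
    have h6 : ∑ x ∈ C, ((neighbors r₀ C x).card : ℝ) + 2 * ((P.image Prod.fst).card +
      (P.image Prod.snd).card) ≤ 4 * n := by exact_mod_cast h5
    rw [h1] at hE
    have h7 : (((P.image Prod.fst).card + (P.image Prod.snd).card : ℕ) : ℝ) ≤ R := by
      push_cast; linarith
    exact_mod_cast h7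

end

/-! ### Comparison with the square -/

theorem card_symmDiff_le {P : Finset (ℤ × ℤ)} {a b m : ℕ}
    (hP : P ⊆ Finset.Icc (1 : ℤ) a ×ˢ Finset.Icc (1 : ℤ) b) :
    (P ∆ (Finset.Icc (1 : ℤ) m ×ˢ Finset.Icc (1 : ℤ) m)).card + P.card ≤
      m ^ 2 + 2 * ((a - m) * b + a * (b - m)) := by
  classical
  set Q := Finset.Icc (1 : ℤ) m ×ˢ Finset.Icc (1 : ℤ) m with hQ
  have hQc : Q.card = m ^ 2 := by
    rw [hQ, Finset.card_product, Int.card_Icc, sq]; simp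
  have h1 : (P \ Q).card ≤ (a - m) * b + a * (b - m) := by
    have hsub : P \ Q ⊆ (Finset.Icc ((m : ℤ) + 1) a ×ˢ Finset.Icc (1 : ℤ) b) ∪
        (Finset.Icc (1 : ℤ) a ×ˢ Finset.Icc ((m : ℤ) + 1) b) := by
      intro p hp
      obtain ⟨hp, hn⟩ := Finset.mem_sdiff.1 hp
      have := hP hp
      simp only [hQ, Finset.mem_union, Finset.mem_product, Finset.mem_Icc] at this hn ⊢
      omega
    refine (Finset.card_le_card hsub).trans ((Finset.card_union_le _ _).trans (le_of_eq ?_))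
    rw [Finset.card_product, Finset.card_product]
    simp only [Int.card_Icc]
    congr 1
    · congr 1 <;> omega
    · congr 1 <;> omega
  have h2 : (P ∆ Q).card ≤ (P \ Q).card + (Q \ P).card := by
    rw [symmDiff_def]
    exact Finset.card_union_le _ _
  have h3 := Finset.card_sdiff_add_card_inter P Q
  have h4 := Finset.card_sdiff_add_card_inter Q P
  rw [Finset.inter_comm] at h4
  omega

theorem square_eq_image (n : ℕ) :
    square n = (Finset.Icc (1 : ℤ) ⌈Real.sqrt n⌉₊ ×ˢ Finset.Icc (1 : ℤ) ⌈Real.sqrt n⌉₊).image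
      latticePoint := by
  rw [square, Int.natCast_ceil_eq_ceil (Real.sqrt_nonneg _)]
  rfl

theorem deficit_le {a b m n R : ℕ} {t : ℝ} (ht : 1 ≤ t) (hn : (n : ℝ) = t ^ 4)
    (hab : a + b ≤ R) (hR : (R : ℝ) ≤ 2 * t ^ 2 + 1) (hle : n ≤ a * b) (hm1 : t ^ 2 ≤ m)
    (hm2 : (m : ℝ) ≤ t ^ 2 + 1) :
    (m : ℝ) ^ 2 + 2 * (((a - m : ℕ) : ℝ) * b + a * ((b - m : ℕ) : ℝ)) ≤ n + 27 * t ^ 3 := by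
  have h1 : (a : ℝ) + b ≤ 2 * t ^ 2 + 1 := le_trans (by exact_mod_cast hab) hR
  have h2 : t ^ 4 ≤ (a : ℝ) * b := by rw [← hn]; exact_mod_cast hle
  have ha0 : (0 : ℝ) ≤ a := Nat.cast_nonneg _
  have hb0 : (0 : ℝ) ≤ b := Nat.cast_nonneg _
  -- From (a - b)² = (a + b)² - 4ab ≤ (2t² + 1)² - 4t⁴ = 4t² + 1.
  have h3 : ((a : ℝ) - b) ^ 2 ≤ (2 * t + 1) ^ 2 := by nlinarith
  have h4 := abs_le_of_sq_le_sq' h3 (by linarith)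
  have ha : (a : ℝ) ≤ t ^ 2 + t + 1 := by linarith [h4.2]
  have hb : (b : ℝ) ≤ t ^ 2 + t + 1 := by linarith [h4.1]
  have hsub : ∀ k : ℕ, (k : ℝ) ≤ t ^ 2 + t + 1 → ((k - m : ℕ) : ℝ) ≤ t + 1 := by
    intro k hk
    rcases le_total k m with h | h
    · rw [Nat.sub_eq_zero_of_le h, Nat.cast_zero]; linarith
    · rw [Nat.cast_sub h]; linarith
  have ht2 : t ≤ t ^ 2 := by nlinarith
  have hbig : ∀ k : ℕ, (k : ℝ) ≤ t ^ 2 + t + 1 → (k : ℝ) ≤ 3 * t ^ 2 := fun k hk => by linarith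
  have e1 : ((a - m : ℕ) : ℝ) * b ≤ (2 * t) * (3 * t ^ 2) :=
    mul_le_mul ((hsub a ha).trans (by linarith)) (hbig b hb) hb0 (by linarith)
  have e2 : (a : ℝ) * ((b - m : ℕ) : ℝ) ≤ (3 * t ^ 2) * (2 * t) :=
    mul_le_mul (hbig a ha) ((hsub b hb).trans (by linarith)) (Nat.cast_nonneg _) (by positivity)
  have e3 : (m : ℝ) ^ 2 ≤ (t ^ 2 + 1) ^ 2 := by gcongr
  have ht3 : t ^ 2 ≤ t ^ 3 := by nlinarith [sq_nonneg t]
  have ht4 : 1 ≤ t ^ 2 := by nlinarith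
  -- The two strips contribute 2(6t³ + 6t³), and m² ≤ t⁴ + 2t² + 1 ≤ n + 3t³, whence the constant
  -- 27.
  nlinarith

end SquareCrystal

end

theorem theorem2 :
    ∃ ε₀ : ℝ, 0 < ε₀ ∧ ε₀ < Real.pi / 6 ∧ ∃ c : ℝ, 0 < c ∧
      ∀ (ε r₀ : ℝ) (v₂ : ℝ → EReal) (v₃ : ℝ → ℝ), 0 < ε → ε < ε₀ →
        SquareCrystal.Admissible ε r₀ v₂ v₃ →
        ∀ (n : ℕ) (C : Finset ℂ), SquareCrystal.IsGroundState r₀ v₂ v₃ n C →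
          ∃ φ : ℂ → ℂ, SquareCrystal.IsRigidMotion φ ∧
            (((C.image φ) ∆ (SquareCrystal.square n)).card : ℝ) ≤ c * (n : ℝ) ^ (3 / 4 : ℝ) := by
  refine ⟨1 / 1000, by norm_num, by linarith [Real.pi_gt_three], 27, by norm_num, ?_⟩
  intro ε r₀ v₂ v₃ hε hε' H n C hG
  rcases Nat.eq_zero_or_pos n with rfl | hn
  · refine ⟨id, ⟨1, 0, by simp, fun z => by simp⟩, ?_⟩
    rw [Finset.card_eq_zero.1 hG.1, SquareCrystal.square_eq_image]
    simp
  set t : ℝ := (n : ℝ) ^ (1 / 4 : ℝ) with ht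
  have hn0 : (0 : ℝ) ≤ n := Nat.cast_nonneg n
  have ht1 : 1 ≤ t := Real.one_le_rpow (by exact_mod_cast hn) (by norm_num)
  have ht4 : (n : ℝ) = t ^ 4 := by
    rw [ht, ← Real.rpow_natCast, ← Real.rpow_mul hn0]; norm_num
  have ht3 : (n : ℝ) ^ (3 / 4 : ℝ) = t ^ 3 := by
    rw [ht, ← Real.rpow_natCast, ← Real.rpow_mul hn0]; norm_num
  have hs : Real.sqrt n = t ^ 2 := by
    rw [ht4, show t ^ 4 = (t ^ 2) ^ 2 by ring, Real.sqrt_sq (by positivity)]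
  -- The least admissible R is ⌈2√n⌉, with √n = t²; rounding up costs at most 1 in the half
  -- perimeter.
  have hR : 4 * n ≤ ⌈2 * t ^ 2⌉₊ ^ 2 := by
    have h1 := Nat.le_ceil (2 * t ^ 2)
    have h2 : (4 * n : ℝ) ≤ (⌈2 * t ^ 2⌉₊ : ℝ) ^ 2 := by
      calc (4 * n : ℝ) = (2 * t ^ 2) ^ 2 := by rw [ht4]; ring
        _ ≤ _ := by gcongr
    exact_mod_cast h2
  obtain ⟨φ, P, a, b, hφ, hPn, hP, hsub, hab⟩ :=
    SquareCrystal.IsGroundState.exists_rectangle H hG hε hε' hn hR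
  refine ⟨φ, hφ, ?_⟩
  rw [hP, SquareCrystal.square_eq_image,
    ← Finset.image_symmDiff _ _ SquareCrystal.latticePoint_injective,
    Finset.card_image_of_injective _ SquareCrystal.latticePoint_injective, ht3]
  have h1 := SquareCrystal.card_symmDiff_le (m := ⌈Real.sqrt n⌉₊) hsub
  have h2 := Finset.card_le_card hsub
  rw [Finset.card_product, Int.card_Icc, Int.card_Icc, hPn] at h2
  have h3 := SquareCrystal.deficit_le ht1 ht4 hab (Nat.ceil_lt_add_one (by positivity)).le
    (by simpa using h2) (hs ▸ Nat.le_ceil (Real.sqrt n))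
    (hs ▸ (Nat.ceil_lt_add_one (Real.sqrt_nonneg n)).le)
  rw [hPn] at h1
  have h4 : (((P ∆ (Finset.Icc (1 : ℤ) ⌈Real.sqrt n⌉₊ ×ˢ Finset.Icc (1 : ℤ) ⌈Real.sqrt n⌉₊)).card
    : ℝ) + n) ≤ (⌈Real.sqrt n⌉₊ : ℝ) ^ 2 + 2 * (((a - ⌈Real.sqrt n⌉₊ : ℕ) : ℝ) * b +
      a * ((b - ⌈Real.sqrt n⌉₊ : ℕ) : ℝ)) := by exact_mod_cast h1
  rw [hs] at h4 ⊢
  linarith
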